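/- All graphs are finite and simple. A straight-line drawing of a graph $G$ maps the vertices of $G$ to distinct points of the plane and every edge to the straight-line segment joining its end-vertices, so that this segment passes through no other vertex. The slope of an edge is the family of all straight lines parallel to it. The drawing is planar if no two edges meet in a point other than a common end-vertex, and outerplanar if, moreover, all vertices lie on the boundary of the outer face (the unbounded connected component of the complement of the drawing). A graph is outerplanar if it has an outerplanar drawing (which can then be taken to be straight-line), and the outerplanar slope number of an outerplanar graph $G$ is the smallest number $s$ such that some outerplanar straight-line drawing of $G$ uses exactly $s$ distinct edge slopes. For $\Delta\ge 4$, let $G_\Delta$ be the graph consisting of a cycle on $2\Delta-3$ vertices in which each cycle vertex has $\Delta-2$ additional private neighbours, each of degree one. Then for every integer $\Delta\ge 4$ the graph $G_\Delta$ is outerplanar, has maximum degree exactly $\Delta$, and has outerplanar slope number at least $\Delta-1$. Moreover, the triangle $K_3$ is outerplanar, has maximum degree $2$ (hence at most $\Delta$ for $\Delta\in\{2,3\}$), and has outerplanar slope number at least $3$. -/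

import Mathlib

/-- The Euclidean plane. -/
abbrev Plane : Type := EuclideanSpace ℝ (Fin 2)

/-- A straight-line drawing of `G`: vertices go to distinct points of the plane, and the straight-line
segment representing an edge passes through no vertex other than its two end-vertices. -/
structure StraightLineDrawing {V : Type*} (G : SimpleGraph V) where
  pos : V → Plane
  pos_injective : Function.Injective pos
  eq_or_eq_of_mem_segment : ∀ u v w : V, G.Adj u v →
    pos w ∈ segment ℝ (pos u) (pos v) → w = u ∨ w = v

namespace StraightLineDrawing

variable {V : Type*} {G : SimpleGraph V}

/-- The slope of the segment `uv`: the family of all straight lines parallel to it. -/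
def slope (D : StraightLineDrawing G) (u v : V) : Set (AffineSubspace ℝ Plane) :=
  {l | l.Parallel (affineSpan ℝ {D.pos u, D.pos v})}

/-- The set of slopes used by the edges of the drawing. -/
def slopes (D : StraightLineDrawing G) : Set (Set (AffineSubspace ℝ Plane)) :=
  {σ | ∃ u v : V, G.Adj u v ∧ σ = D.slope u v}

/-- The drawing is planar: any point shared by two different edges is a common end-vertex of them. -/
def IsPlanar (D : StraightLineDrawing G) : Prop :=
  ∀ u v x y : V, G.Adj u v → G.Adj x y → s(u, v) ≠ s(x, y) →
    ∀ p : Plane, p ∈ segment ℝ (D.pos u) (D.pos v) → p ∈ segment ℝ (D.pos x) (D.pos y) →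
      ∃ w : V, (w = u ∨ w = v) ∧ (w = x ∨ w = y) ∧ p = D.pos w

/-- The subset of the plane covered by the vertices and the edges. -/
def support (D : StraightLineDrawing G) : Set Plane :=
  Set.range D.pos ∪ {p | ∃ u v : V, G.Adj u v ∧ p ∈ segment ℝ (D.pos u) (D.pos v)}

/-- The outer face: the unbounded connected component of the complement of the drawing. -/
def outerFace (D : StraightLineDrawing G) : Set Plane :=
  {p | p ∈ D.supportᶜ ∧ ¬ Bornology.IsBounded (connectedComponentIn D.supportᶜ p)}

/-- The drawing is outerplanar: it is planar and all vertices lie on (the boundary of) the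
outer face. -/
def IsOuterplanar (D : StraightLineDrawing G) : Prop :=
  D.IsPlanar ∧ ∀ v : V, D.pos v ∈ frontier D.outerFace

end StraightLineDrawing

/-- `G` is outerplanar: it has an outerplanar (straight-line) drawing. -/
def IsOuterplanarGraph {V : Type*} (G : SimpleGraph V) : Prop :=
  ∃ D : StraightLineDrawing G, D.IsOuterplanar

/-- The outerplanar slope number: the smallest `s` such that some outerplanar straight-line drawing
of `G` uses exactly `s` slopes (meaningful for finite outerplanar graphs). -/
noncomputable def outerplanarSlopeNumber {V : Type*} (G : SimpleGraph V) : ℕ :=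
  sInf {s : ℕ | ∃ D : StraightLineDrawing G, D.IsOuterplanar ∧ D.slopes.encard = (s : ℕ∞)}

/-- The cycle on `n` vertices (the vertices `Sum.inl i`) in which every cycle vertex `i` has `k`
additional private neighbours of degree one (the vertices `Sum.inr (i, a)`). -/
def cycleWithPendants (n k : ℕ) : SimpleGraph (Fin n ⊕ Fin n × Fin k) where
  Adj
    | Sum.inl i, Sum.inl j => (SimpleGraph.cycleGraph n).Adj i j
    | Sum.inl i, Sum.inr b => i = b.1
    | Sum.inr b, Sum.inl i => i = b.1
    | Sum.inr _, Sum.inr _ => False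
  symm := ⟨by rintro (i | b) (j | c) h <;> first | exact h.symm | exact h⟩
  loopless := ⟨by rintro (i | b) h <;> first | exact h.ne rfl | exact h⟩

instance (n k : ℕ) : DecidableRel (cycleWithPendants n k).Adj := fun x y =>
  match x, y with
  | Sum.inl i, Sum.inl j => inferInstanceAs (Decidable ((SimpleGraph.cycleGraph n).Adj i j))
  | Sum.inl i, Sum.inr b => inferInstanceAs (Decidable (i = b.1))
  | Sum.inr b, Sum.inl i => inferInstanceAs (Decidable (i = b.1))
  | Sum.inr _, Sum.inr _ => inferInstanceAs (Decidable False)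

/-!
The lower bound is an angle count. Let `n = 2Δ - 3` and `k = Δ - 2`, and let an outerplanar drawing
of the cycle with pendants use `s` slopes, that is, `2s` directions. Distort all angles by a step
function of the circle which assigns the weight `1` to every direction in use, so that a half-turn
always has weight `s` (`angleCount`). The angle sum of a simple `n`-gon is `n - 2` half-turns, also
after the distortion, because it telescopes; and at each vertex the `k` pendants, which are drawn
outside the cycle, take away at least `k + 1` of the full turn `2s`. Hence
`(n - 2) s ≤ n (2s - (k + 1))`, which for these values fails when `s ≤ Δ - 2`
(`mul_le_mul_of_encard_slopes`).

The angle sum is obtained in the manner of Hopf. Between disjoint segments the direction of a secant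
has no holonomy, since the four differences of end-points lie in an open half-plane
(`turnAngle_square`). So the direction of the secant from `p i` to `p j`, `i < j < i + n`, has a
consistent lift `secantAngle p i j` to `ℝ`. Replacing it by the secant from `p j` to `p (i + n)`
adds one and the same odd multiple of `π` to all lifts
(`IsSimplePolygon.exists_int_secantAngle_swap_eq`), and with this the sum of the polygon angles
telescopes, whichever step function is applied to the lifts (`IsSimplePolygon.mul_le_mul_card`).

No Jordan curve theorem is needed to place the pendants. The winding number is locally constant off
the polygon and vanishes far away, hence vanishes on the closure of the outer face, off the polygon
(`StraightLineDrawing.totalTurn_eq_zero_of_mem_closure_outerFace`). Moving the base point from a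
vertex to the end of a pendant there turns this into the position of the direction of the pendant
relative to the two cycle edges at the vertex (`IsSimplePolygon.turnAngle_add_turnAngle_eq`).

The cycle with pendants is drawn with the cycle on a parabola and the pendants below it; vertices
are seen to be on the outer face along vertical rays pointing downwards. The triangle is a subgraph
of such a graph, and its three sides have distinct slopes in every drawing.
-/

/-! ### Angles between plane vectors -/

/-- `θ` is an angle of polar coordinates for `z`; every `θ` is one for `z = 0`. -/
def IsAngleOf (θ : ℝ) (z : ℂ) : Prop :=
  z = ‖z‖ * Complex.exp (θ * Complex.I)

/-- The angle in `(-π, π]` taking the direction of `a` to the direction of `b`. -/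
noncomputable def turnAngle (a b : ℂ) : ℝ := (b / a).arg

theorem isAngleOf_arg (z : ℂ) : IsAngleOf z.arg z :=
  (Complex.norm_mul_exp_arg_mul_I z).symm

theorem IsAngleOf.add_turnAngle {θ : ℝ} {a b : ℂ} (h : IsAngleOf θ a) (ha : a ≠ 0) :
    IsAngleOf (θ + turnAngle a b) b := by
  have hb : b = a * (b / a) := by field_simp
  have h2 := Complex.norm_mul_exp_arg_mul_I (b / a)
  have hn : (‖a‖ : ℂ) * (‖b / a‖ : ℂ) = (‖b‖ : ℂ) := by
    have : ‖a‖ ≠ 0 := norm_ne_zero_iff.mpr ha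
    rw [norm_div, ← Complex.ofReal_mul, mul_div_cancel₀ _ this]
  unfold IsAngleOf turnAngle at *
  push_cast
  rw [add_mul, Complex.exp_add, ← hn]
  calc b = a * (b / a) := hb
    _ = (‖a‖ * Complex.exp (θ * Complex.I)) *
        (‖b / a‖ * Complex.exp ((b / a).arg * Complex.I)) := by rw [h2, ← h]
    _ = _ := by ring

theorem IsAngleOf.neg {θ : ℝ} {z : ℂ} (h : IsAngleOf θ z) : IsAngleOf (θ + Real.pi) (-z) := by
  unfold IsAngleOf at *
  push_cast
  rw [add_mul, Complex.exp_add, Complex.exp_pi_mul_I, norm_neg]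
  linear_combination -h

theorem IsAngleOf.add_two_pi {θ : ℝ} {z : ℂ} (h : IsAngleOf θ z) :
    IsAngleOf (θ + 2 * Real.pi) z := by
  have := h.neg.neg
  rwa [neg_neg, add_assoc, ← two_mul] at this

theorem IsAngleOf.exists_int_eq {θ φ : ℝ} {z : ℂ} (h : IsAngleOf θ z) (h' : IsAngleOf φ z)
    (hz : z ≠ 0) :
    ∃ m : ℤ, θ = φ + m * (2 * Real.pi) := by
  have hn : (‖z‖ : ℂ) ≠ 0 := by simpa using hz
  have he : Complex.exp (θ * Complex.I) = Complex.exp (φ * Complex.I) :=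
    mul_left_cancel₀ hn (h.symm.trans h')
  obtain ⟨m, hm⟩ := Complex.exp_eq_exp_iff_exists_int.mp he
  refine ⟨m, ?_⟩
  have := congrArg Complex.im hm
  simpa using this

/-- Angles of proportional vectors agree modulo `π`. -/
theorem IsAngleOf.eq_add_int_mul_pi {θ φ r : ℝ} {z w : ℂ} (h : IsAngleOf θ z)
    (h' : IsAngleOf φ w) (hw : w ≠ 0) (hr : r ≠ 0) (hzw : z = r * w) :
    ∃ m : ℤ, θ = φ + m * Real.pi := by
  rcases lt_or_gt_of_ne hr with hr | hr
  · have h1 : IsAngleOf (φ + Real.pi) z := by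
      have := h'.neg
      unfold IsAngleOf at *
      rw [hzw, norm_mul, Complex.norm_real, Real.norm_of_nonpos hr.le]
      rw [norm_neg] at this
      push_cast at this ⊢
      linear_combination (-(r : ℂ)) * this
    obtain ⟨m, hm⟩ := h.exists_int_eq h1 (by rw [hzw]; simp [hw, hr.ne])
    exact ⟨2 * m + 1, by push_cast; linarith⟩
  · have h1 : IsAngleOf φ z := by
      unfold IsAngleOf at *
      rw [hzw, norm_mul, Complex.norm_real, Real.norm_of_nonneg hr.le]
      push_cast
      linear_combination (r : ℂ) * h'
    obtain ⟨m, hm⟩ := h.exists_int_eq h1 (by rw [hzw]; simp [hw, hr.ne'])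
    exact ⟨2 * m, by push_cast; linarith⟩

theorem IsAngleOf.sameRay {θ : ℝ} {z w : ℂ} (h : IsAngleOf θ z) (h' : IsAngleOf θ w) :
    SameRay ℝ z w := by
  have hz : z = ‖z‖ • Complex.exp (θ * Complex.I) := by
    rw [Complex.real_smul]; exact h
  have hw : w = ‖w‖ • Complex.exp (θ * Complex.I) := by
    rw [Complex.real_smul]; exact h'
  rw [hz, hw]
  exact (SameRay.sameRay_nonneg_smul_left _ (norm_nonneg z)).nonneg_smul_right (norm_nonneg w)

theorem turnAngle_neg_neg (a b : ℂ) : turnAngle (-a) (-b) = turnAngle a b := by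
  unfold turnAngle; rw [neg_div_neg_eq]

theorem turnAngle_sub_sub_comm (a b c d : ℂ) :
    turnAngle (a - b) (c - d) = turnAngle (b - a) (d - c) := by
  rw [← turnAngle_neg_neg, neg_sub, neg_sub]

theorem turnAngle_self (a : ℂ) : turnAngle a a = 0 := by
  unfold turnAngle
  by_cases h : a = 0 <;> simp [h]

theorem neg_pi_lt_turnAngle (a b : ℂ) : -Real.pi < turnAngle a b := Complex.neg_pi_lt_arg _

theorem turnAngle_le_pi (a b : ℂ) : turnAngle a b ≤ Real.pi := Complex.arg_le_pi _

/-- A rotation by exactly `π` reverses the direction. -/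
theorem sameRay_neg_of_turnAngle_eq_pi {a b : ℂ} (ha : a ≠ 0) (h : turnAngle a b = Real.pi) :
    SameRay ℝ a (-b) := by
  have h2 := ((isAngleOf_arg a).add_turnAngle (b := b) ha).neg
  rw [h] at h2
  refine ((isAngleOf_arg a).add_two_pi).sameRay ?_
  rwa [two_mul, ← add_assoc]

theorem turnAngle_eq_sub_arg {a b w : ℂ} (ha : 0 < (a * w).re) (hb : 0 < (b * w).re) :
    turnAngle a b = (b * w).arg - (a * w).arg := by
  have hw : w ≠ 0 := by rintro rfl; simp at ha
  have ha0 : a * w ≠ 0 := by intro h; simp [h] at ha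
  have hb0 : b * w ≠ 0 := by intro h; simp [h] at hb
  have h1 := abs_lt.mp (Complex.abs_arg_lt_pi_div_two_iff.mpr (Or.inl ha))
  have h2 := abs_lt.mp (Complex.abs_arg_lt_pi_div_two_iff.mpr (Or.inl hb))
  have h3 : b / a = b * w / (a * w) := by rw [mul_div_mul_right _ _ hw]
  unfold turnAngle
  rw [h3, ← Complex.arg_coe_angle_toReal_eq_arg, Complex.arg_div_coe_angle hb0 ha0,
    ← Real.Angle.coe_sub, Real.Angle.toReal_coe_eq_self_iff.mpr]
  constructor <;> linarith

/-- Rotations between vectors of an open half-plane are additive. -/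
theorem turnAngle_add_turnAngle {a b c w : ℂ} (ha : 0 < (a * w).re) (hb : 0 < (b * w).re)
    (hc : 0 < (c * w).re) : turnAngle a b + turnAngle b c = turnAngle a c := by
  rw [turnAngle_eq_sub_arg ha hb, turnAngle_eq_sub_arg hb hc, turnAngle_eq_sub_arg ha hc]
  ring

theorem exists_halfPlane_of_not_sameRay_neg {a b : ℂ} (ha : a ≠ 0) (hb : b ≠ 0)
    (h : ¬ SameRay ℝ a (-b)) : ∃ w : ℂ, 0 < (a * w).re ∧ 0 < (b * w).re := by
  have hr : turnAngle a b ≠ Real.pi := fun h' => h (sameRay_neg_of_turnAngle_eq_pi ha h')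
  have hlt := lt_of_le_of_ne (turnAngle_le_pi a b) hr
  have hgt := neg_pi_lt_turnAngle a b
  have h1 := isAngleOf_arg a
  have h2 := h1.add_turnAngle (b := b) ha
  -- the bisector of the directions of `a` and `b`
  have key : ∀ (z : ℂ) (t : ℝ), z ≠ 0 → IsAngleOf t z →
      |t - (a.arg + turnAngle a b / 2)| < Real.pi / 2 →
      0 < (z * Complex.exp (((-(a.arg + turnAngle a b / 2) : ℝ) : ℂ) * Complex.I)).re := by
    intro z t hz ht hlt
    have : z * Complex.exp (((-(a.arg + turnAngle a b / 2) : ℝ) : ℂ) * Complex.I) =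
        (‖z‖ : ℂ) * Complex.exp (((t - (a.arg + turnAngle a b / 2) : ℝ) : ℂ) * Complex.I) := by
      conv_lhs => rw [ht]
      rw [mul_assoc, ← Complex.exp_add]
      push_cast
      ring_nf
    rw [this, Complex.re_ofReal_mul, Complex.exp_ofReal_mul_I_re]
    exact mul_pos (norm_pos_iff.mpr hz) (Real.cos_pos_of_mem_Ioo (abs_lt.mp hlt))
  refine ⟨_, key a _ ha h1 ?_, key b _ hb h2 ?_⟩
  · rw [abs_lt]; constructor <;> linarith
  · rw [abs_lt]; constructor <;> linarith

/-- In a nondegenerate triangle the rotations along two sides add up. -/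
theorem turnAngle_add_self {a b : ℂ} (ha : a ≠ 0) (hb : b ≠ 0) (h : ¬ SameRay ℝ a (-b)) :
    turnAngle a (a + b) + turnAngle (a + b) b = turnAngle a b := by
  obtain ⟨w, h1, h2⟩ := exists_halfPlane_of_not_sameRay_neg ha hb h
  exact turnAngle_add_turnAngle h1 (by rw [add_mul, Complex.add_re]; exact add_pos h1 h2) h2

theorem turnAngle_comm_of_halfPlane {a b w : ℂ} (ha : 0 < (a * w).re) (hb : 0 < (b * w).re) :
    turnAngle a b = - turnAngle b a := by
  rw [turnAngle_eq_sub_arg ha hb, turnAngle_eq_sub_arg hb ha]; ring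

theorem exists_halfPlane_of_disjoint_segment {a b c d : ℂ}
    (h : Disjoint (segment ℝ a b) (segment ℝ c d)) :
    ∃ w : ℂ, ∀ x ∈ segment ℝ a b, ∀ y ∈ segment ℝ c d, 0 < ((y - x) * w).re := by
  have hc : ∀ x y : ℂ, IsCompact (segment ℝ x y) := fun x y => by
    rw [segment_eq_image]
    exact isCompact_Icc.image (by fun_prop)
  obtain ⟨f, u, v, hu, huv, hv⟩ := geometric_hahn_banach_compact_closed (convex_segment a b)
    (hc a b) (convex_segment c d) (hc c d).isClosed h
  refine ⟨⟨f 1, - f Complex.I⟩, fun x hx y hy => ?_⟩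
  have hf : ∀ z : ℂ, (z * (⟨f 1, - f Complex.I⟩ : ℂ)).re = f z := fun z => by
    have hz : z = z.re • (1 : ℂ) + z.im • Complex.I := by
      apply Complex.ext <;> simp
    conv_rhs => rw [hz, map_add, map_smul, map_smul]
    simp
  rw [hf, map_sub]
  linarith [hu x hx, hv y hy]

/-- The direction of a secant between two disjoint segments has no holonomy around the square of
their end-points. -/
theorem turnAngle_square {a b c d : ℂ} (h : Disjoint (segment ℝ a b) (segment ℝ c d)) :
    turnAngle (c - a) (d - a) + turnAngle (d - a) (d - b) =
      turnAngle (c - a) (c - b) + turnAngle (c - b) (d - b) := by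
  obtain ⟨w, hw⟩ := exists_halfPlane_of_disjoint_segment h
  have ha := left_mem_segment ℝ a b
  have hb := right_mem_segment ℝ a b
  have hc := left_mem_segment ℝ c d
  have hd := right_mem_segment ℝ c d
  rw [turnAngle_add_turnAngle (hw a ha c hc) (hw a ha d hd) (hw b hb d hd),
    turnAngle_add_turnAngle (hw a ha c hc) (hw b hb c hc) (hw b hb d hd)]

/-! ### Secant directions of a simple polygon -/

/-- `p` runs periodically through the vertices of a simple closed polygon with `n` vertices. -/
structure IsSimplePolygon (n : ℕ) (p : ℕ → ℂ) : Prop where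
  three_le : 3 ≤ n
  periodic : ∀ i, p (i + n) = p i
  ne : ∀ i j, i < j → j < i + n → p i ≠ p j
  disjoint : ∀ i j, i + 2 ≤ j → j + 2 ≤ i + n →
    Disjoint (segment ℝ (p i) (p (i + 1))) (segment ℝ (p j) (p (j + 1)))

/-- A lift to `ℝ` of the direction of the edge from `p i` to `p (i + 1)`. From one edge to the next
the secant first moves its head to `p (i + 2)` and then its tail to `p (i + 1)`. -/
noncomputable def edgeAngle (p : ℕ → ℂ) : ℕ → ℝ
  | 0 => (p 1 - p 0).arg
  | i + 1 => edgeAngle p i + turnAngle (p (i + 1) - p i) (p (i + 2) - p i) +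
      turnAngle (p (i + 2) - p i) (p (i + 2) - p (i + 1))

/-- A lift to `ℝ` of the direction of the secant from `p i` to `p j`, meaningful for
`i < j < i + n`. -/
noncomputable def secantAngle (p : ℕ → ℂ) (i j : ℕ) : ℝ :=
  edgeAngle p i + ∑ k ∈ Finset.Ico (i + 1) j, turnAngle (p k - p i) (p (k + 1) - p i)

theorem secantAngle_self_succ (p : ℕ → ℂ) (i : ℕ) : secantAngle p i (i + 1) = edgeAngle p i := by
  simp [secantAngle]

theorem secantAngle_succ_right (p : ℕ → ℂ) {i j : ℕ} (h : i < j) :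
    secantAngle p i (j + 1) = secantAngle p i j + turnAngle (p j - p i) (p (j + 1) - p i) := by
  unfold secantAngle
  rw [Finset.sum_Ico_succ_top (by omega)]
  ring

namespace IsSimplePolygon

variable {n : ℕ} {p : ℕ → ℂ}

theorem isAngleOf_secantAngle_of_edge (P : IsSimplePolygon n p) {i : ℕ}
    (h : IsAngleOf (edgeAngle p i) (p (i + 1) - p i)) {j : ℕ} (hij : i < j) (hj : j < i + n) :
    IsAngleOf (secantAngle p i j) (p j - p i) := by
  induction j, hij using Nat.le_induction with
  | base => rwa [secantAngle_self_succ]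
  | succ j hij ih =>
    rw [secantAngle_succ_right p hij]
    exact (ih (by omega)).add_turnAngle (sub_ne_zero.mpr (P.ne i j hij (by omega)).symm)

theorem isAngleOf_edgeAngle (P : IsSimplePolygon n p) (i : ℕ) :
    IsAngleOf (edgeAngle p i) (p (i + 1) - p i) := by
  have hn := P.three_le
  induction i with
  | zero => exact isAngleOf_arg _
  | succ i ih =>
    have h := P.isAngleOf_secantAngle_of_edge ih (j := i + 2) (by omega) (by omega)
    rw [secantAngle_succ_right p (by omega), secantAngle_self_succ] at h
    exact h.add_turnAngle (sub_ne_zero.mpr (P.ne i (i + 2) (by omega) (by omega)).symm)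

theorem isAngleOf_secantAngle (P : IsSimplePolygon n p) {i j : ℕ} (hij : i < j)
    (hj : j < i + n) : IsAngleOf (secantAngle p i j) (p j - p i) :=
  P.isAngleOf_secantAngle_of_edge (P.isAngleOf_edgeAngle i) hij hj

theorem secantAngle_succ_left (P : IsSimplePolygon n p) {i j : ℕ} (hij : i + 2 ≤ j)
    (hj : j < i + n) :
    secantAngle p (i + 1) j = secantAngle p i j + turnAngle (p j - p i) (p j - p (i + 1)) := by
  induction j, hij using Nat.le_induction with
  | base =>
    rw [secantAngle_self_succ, secantAngle_succ_right p (by omega), secantAngle_self_succ,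
      edgeAngle]
  | succ j hij ih =>
    rw [secantAngle_succ_right p (by omega), secantAngle_succ_right p (by omega),
      ih (by omega)]
    linarith [turnAngle_square (P.disjoint i j hij (by omega))]

/-- Exchanging head and tail changes the lifted direction of every secant by the same amount. -/
theorem exists_secantAngle_swap_eq (P : IsSimplePolygon n p) :
    ∃ c : ℝ, ∀ i j, i < j → j < i + n → secantAngle p j (i + n) = secantAngle p i j + c := by
  have hn := P.three_le
  have hstep : ∀ i, secantAngle p (i + 2) (i + 1 + n) - edgeAngle p (i + 1) =
      secantAngle p (i + 1) (i + n) - edgeAngle p i := by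
    intro i
    have h1 : i + 1 + n = i + n + 1 := by omega
    have h2 : p (i + n + 1) = p (i + 1) := by rw [← h1, P.periodic]
    rw [h1, secantAngle_succ_right p (by omega), P.secantAngle_succ_left (by omega) (by omega),
      P.periodic, h2, edgeAngle, turnAngle_sub_sub_comm (p i) (p (i + 1)) (p i),
      turnAngle_sub_sub_comm (p i) (p (i + 2)) (p (i + 1))]
    ring
  have hc : ∀ i, secantAngle p (i + 1) (i + n) - edgeAngle p i =
      secantAngle p 1 n - edgeAngle p 0 := by
    intro i
    induction i with
    | zero => rw [zero_add, zero_add]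
    | succ i ih => rw [hstep, ih]
  refine ⟨secantAngle p 1 n - edgeAngle p 0, fun i j hij hj => ?_⟩
  induction j, hij using Nat.le_induction with
  | base => rw [Nat.succ_eq_add_one, secantAngle_self_succ, ← hc i]; ring
  | succ j hij ih =>
    rw [secantAngle_succ_right p hij, P.secantAngle_succ_left (by omega) (by omega),
      ih (by omega), P.periodic, turnAngle_sub_sub_comm (p i)]
    ring

/-- Exchanging head and tail adds an odd, hence nonzero, multiple of `π` to the lifted direction of
a secant. -/
theorem exists_int_secantAngle_swap_eq (P : IsSimplePolygon n p) :
    ∃ m : ℤ, m ≠ 0 ∧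
      ∀ i j, i < j → j < i + n → secantAngle p j (i + n) = secantAngle p i j + m * Real.pi := by
  have hn := P.three_le
  obtain ⟨c, hc⟩ := P.exists_secantAngle_swap_eq
  have h0 := hc 0 1 (by omega) (by omega)
  have h1 := P.isAngleOf_secantAngle (i := 1) (j := 0 + n) (by omega) (by omega)
  have h2 := (P.isAngleOf_secantAngle (i := 0) (j := 1) (by omega) (by omega)).neg
  rw [P.periodic] at h1
  rw [neg_sub] at h2
  obtain ⟨m, hm⟩ := h1.exists_int_eq h2 (sub_ne_zero.mpr (P.ne 0 1 (by omega) (by omega)))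
  refine ⟨2 * m + 1, by omega, fun i j hij hj => ?_⟩
  rw [hc i j hij hj]
  push_cast
  linarith

end IsSimplePolygon

/-! ### Counting angles modulo `π` -/

/-- A step function increasing by one at every angle congruent modulo `π` to an element of `Φ`
(with multiplicity). -/
noncomputable def angleCount (Φ : Finset ℝ) (t : ℝ) : ℤ :=
  ∑ φ ∈ Φ, ⌊(t - φ) / Real.pi⌋

theorem angleCount_add_int_mul_pi (Φ : Finset ℝ) (t : ℝ) (m : ℤ) :
    angleCount Φ (t + m * Real.pi) = angleCount Φ t + m * Φ.card := by
  have h : ∀ φ ∈ Φ, ⌊(t + m * Real.pi - φ) / Real.pi⌋ = ⌊(t - φ) / Real.pi⌋ + m := by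
    intro φ _
    rw [← Int.floor_add_intCast]
    congr 1
    field_simp
    ring
  unfold angleCount
  rw [Finset.sum_congr rfl h, Finset.sum_add_distrib, Finset.sum_const, nsmul_eq_mul, mul_comm m]

theorem card_le_angleCount_sub {Φ X : Finset ℝ} {a b : ℝ} (hab : ∀ x ∈ X, a < x ∧ x ≤ b)
    (hX : ∀ x ∈ X, ∃ φ ∈ Φ, ∃ m : ℤ, x = φ + m * Real.pi) (hle : a ≤ b) :
    (X.card : ℤ) ≤ angleCount Φ b - angleCount Φ a := by
  classical
  have hpi := Real.pi_pos
  have hcover : X ⊆ Φ.biUnion fun φ => X.filter fun x => ∃ m : ℤ, x = φ + m * Real.pi := by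
    intro x hx
    obtain ⟨φ, hφ, m, hm⟩ := hX x hx
    exact Finset.mem_biUnion.mpr ⟨φ, hφ, Finset.mem_filter.mpr ⟨hx, m, hm⟩⟩
  have hcard : ∀ φ ∈ Φ, ((X.filter fun x => ∃ m : ℤ, x = φ + m * Real.pi).card : ℤ) ≤
      ⌊(b - φ) / Real.pi⌋ - ⌊(a - φ) / Real.pi⌋ := by
    intro φ _
    have hfl : ⌊(a - φ) / Real.pi⌋ ≤ ⌊(b - φ) / Real.pi⌋ := Int.floor_le_floor (by gcongr)
    have hround : ∀ m : ℤ, ⌊(φ + m * Real.pi - φ) / Real.pi⌋ = m := fun m => by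
      rw [add_sub_cancel_left, mul_div_cancel_right₀ _ hpi.ne', Int.floor_intCast]
    have h := Finset.card_le_card_of_injOn
      (s := X.filter fun x => ∃ m : ℤ, x = φ + m * Real.pi)
      (t := Finset.Ioc ⌊(a - φ) / Real.pi⌋ ⌊(b - φ) / Real.pi⌋)
      (fun x => ⌊(x - φ) / Real.pi⌋) ?_ ?_
    · rw [Int.card_Ioc] at h
      omega
    · intro x hx
      obtain ⟨hx, m, rfl⟩ := Finset.mem_filter.mp hx
      obtain ⟨h1, h2⟩ := hab _ hx
      simp only [hround, Finset.coe_Ioc, Set.mem_Ioc]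
      rw [Int.floor_lt, Int.le_floor, div_lt_iff₀ hpi, le_div_iff₀ hpi]
      constructor <;> linarith
    · intro x hx y hy hxy
      obtain ⟨_, m, rfl⟩ := Finset.mem_filter.mp hx
      obtain ⟨_, m', rfl⟩ := Finset.mem_filter.mp hy
      simp only [hround] at hxy
      rw [hxy]
  have h1 : (X.card : ℤ) ≤
      ∑ φ ∈ Φ, ((X.filter fun x => ∃ m : ℤ, x = φ + m * Real.pi).card : ℤ) := by
    exact_mod_cast (Finset.card_le_card hcover).trans Finset.card_biUnion_le
  refine h1.trans ((Finset.sum_le_sum hcard).trans ?_)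
  rw [Finset.sum_sub_distrib, angleCount, angleCount]

/-- The intervals in question are the two candidates for the outer angle at a vertex whose adjacent
edges have directions `α` and `β`. If the angle `ψ a` of each of `k` distinct directions lies
strictly between `β` and `α + 2π`, and between `α` and `β + 2π`, then both of these intervals contain
at least `k + 1` angles that agree modulo `π` with an element of `Φ`, one of them being the right
end-point. -/
theorem abs_angleCount_sub_le_of_between {Φ : Finset ℝ} {k : ℕ} {α β : ℝ} {ψ : Fin k → ℝ}
    (hψ : Function.Injective ψ)
    (hΦ : ∀ a, ∃ φ ∈ Φ, ∃ m : ℤ, ψ a = φ + m * Real.pi)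
    (hα : ∃ φ ∈ Φ, ∃ m : ℤ, α = φ + m * Real.pi) (hβ : ∃ φ ∈ Φ, ∃ m : ℤ, β = φ + m * Real.pi)
    (h1 : ∀ a, β < ψ a ∧ ψ a < α + 2 * Real.pi) (h2 : ∀ a, α < ψ a ∧ ψ a < β + 2 * Real.pi)
    (h3 : β < α + 2 * Real.pi) (h4 : α < β + 2 * Real.pi) :
    |angleCount Φ β - angleCount Φ α| ≤ 2 * Φ.card - (k + 1) := by
  classical
  have key : ∀ x y : ℝ, (∃ φ ∈ Φ, ∃ m : ℤ, y = φ + m * Real.pi) → x < y + 2 * Real.pi →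
      (∀ a, x < ψ a ∧ ψ a < y + 2 * Real.pi) →
      angleCount Φ x - angleCount Φ y ≤ 2 * Φ.card - (k + 1) := by
    intro x y hy hxy hbd
    have hnot : y + 2 * Real.pi ∉ Finset.univ.image ψ := by
      intro hmem
      obtain ⟨a, _, ha⟩ := Finset.mem_image.mp hmem
      exact (hbd a).2.ne ha
    have h := card_le_angleCount_sub (Φ := Φ)
      (X := insert (y + 2 * Real.pi) (Finset.univ.image ψ)) (a := x) (b := y + 2 * Real.pi)
      ?_ ?_ hxy.le
    · rw [Finset.card_insert_of_notMem hnot, Finset.card_image_of_injective _ hψ,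
        Finset.card_univ, Fintype.card_fin] at h
      have h5 := angleCount_add_int_mul_pi Φ y 2
      push_cast at h h5
      rw [h5] at h
      linarith
    · intro z hz
      rcases Finset.mem_insert.mp hz with rfl | hz
      · exact ⟨hxy, le_rfl⟩
      · obtain ⟨a, _, rfl⟩ := Finset.mem_image.mp hz
        exact ⟨(hbd a).1, (hbd a).2.le⟩
    · intro z hz
      rcases Finset.mem_insert.mp hz with rfl | hz
      · obtain ⟨φ, hφ, m, rfl⟩ := hy
        exact ⟨φ, hφ, m + 2, by push_cast; ring⟩
      · obtain ⟨a, _, rfl⟩ := Finset.mem_image.mp hz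
        exact hΦ a
  rw [abs_le]
  constructor
  · linarith [key α β hβ h4 h2]
  · exact key β α hα h3 h1

/-- The angle of a polygon at the vertex `p (i + 1)` is measured here by the increase of
`angleCount Φ` instead of by the real angle. The angle sum is then `n - 2` half-turns, each worth
`Φ.card`, up to a nonzero integer factor coming from the orientation; so leaving `k + 1` steps of
each full turn `2 * Φ.card` outside the polygon forces `Φ` to be large. -/
theorem IsSimplePolygon.mul_le_mul_card {n : ℕ} {p : ℕ → ℂ} (P : IsSimplePolygon n p)
    {Φ : Finset ℝ} {k : ℕ}
    (h : ∀ i, |angleCount Φ (secantAngle p (i + 1) (i + n)) -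
      angleCount Φ (edgeAngle p (i + 1))| ≤ 2 * Φ.card - (k + 1)) :
    n * (k + 1) ≤ (n + 2) * Φ.card := by
  have hn := P.three_le
  obtain ⟨m, hm0, hm⟩ := P.exists_int_secantAngle_swap_eq
  have h1 : ∀ i, angleCount Φ (secantAngle p (i + 1) (i + n)) =
      angleCount Φ (edgeAngle p i) + m * Φ.card := by
    intro i
    rw [hm i (i + 1) (by omega) (by omega), secantAngle_self_succ, angleCount_add_int_mul_pi]
  have h2 : edgeAngle p n = edgeAngle p 0 + ((2 * m : ℤ) : ℝ) * Real.pi := by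
    have h3 := hm 0 1 (by omega) (by omega)
    have h4 := hm 1 n (by omega) (by omega)
    rw [zero_add, secantAngle_self_succ] at h3
    rw [add_comm 1 n, secantAngle_self_succ, h3] at h4
    rw [h4]; push_cast; ring
  have hsum : ∑ i ∈ Finset.range n, (angleCount Φ (secantAngle p (i + 1) (i + n)) -
      angleCount Φ (edgeAngle p (i + 1))) = (n - 2) * m * Φ.card := by
    have h3 : ∀ i ∈ Finset.range n, angleCount Φ (secantAngle p (i + 1) (i + n)) -
        angleCount Φ (edgeAngle p (i + 1)) = m * Φ.card -
        (angleCount Φ (edgeAngle p (i + 1)) - angleCount Φ (edgeAngle p i)) := by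
      intro i _
      rw [h1]; ring
    rw [Finset.sum_congr rfl h3, Finset.sum_sub_distrib,
      Finset.sum_range_sub (fun i => angleCount Φ (edgeAngle p i)), h2, angleCount_add_int_mul_pi,
      Finset.sum_const, Finset.card_range, nsmul_eq_mul]
    ring
  have hbd : |((n : ℤ) - 2) * m * Φ.card| ≤ n * (2 * Φ.card - (k + 1)) := by
    rw [← hsum]
    refine (Finset.abs_sum_le_sum_abs _ _).trans ((Finset.sum_le_sum fun i _ => h i).trans ?_)
    rw [Finset.sum_const, Finset.card_range, nsmul_eq_mul]
  have hn' : (0 : ℤ) ≤ (n : ℤ) - 2 := by omega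
  have hc : (0 : ℤ) ≤ (Φ.card : ℤ) := by positivity
  rw [abs_mul, abs_mul, abs_of_nonneg hn', abs_of_nonneg hc] at hbd
  have hm1 : (1 : ℤ) ≤ |m| := Int.one_le_abs hm0
  have h8 : ((n : ℤ) - 2) * 1 * Φ.card ≤ ((n : ℤ) - 2) * |m| * Φ.card := by gcongr
  zify
  linarith

/-! ### Winding numbers of closed polygons -/

/-- The total rotation of the vector from `q` to a point running once through the closed polygon
`p 0, …, p n`: it is `2π` times the winding number about `q`. -/
noncomputable def totalTurn (p : ℕ → ℂ) (n : ℕ) (q : ℂ) : ℝ :=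
  ∑ j ∈ Finset.range n, turnAngle (p j - q) (p (j + 1) - q)

theorem exists_int_totalTurn_eq {p : ℕ → ℂ} {n : ℕ} {q : ℂ} (hp : p n = p 0)
    (hq : ∀ j, p j ≠ q) : ∃ m : ℤ, totalTurn p n q = m * (2 * Real.pi) := by
  have h : ∀ j, IsAngleOf ((p 0 - q).arg +
      ∑ k ∈ Finset.range j, turnAngle (p k - q) (p (k + 1) - q)) (p j - q) := by
    intro j
    induction j with
    | zero => simpa using isAngleOf_arg (p 0 - q)
    | succ j ih =>
      rw [Finset.sum_range_succ, ← add_assoc]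
      exact ih.add_turnAngle (sub_ne_zero.mpr (hq j))
  have hn := h n
  rw [hp] at hn
  obtain ⟨m, hm⟩ := hn.exists_int_eq (isAngleOf_arg _) (sub_ne_zero.mpr (hq 0))
  exact ⟨m, by unfold totalTurn; linarith⟩

theorem div_mem_slitPlane_of_notMem_segment {a b q : ℂ} (h : q ∉ segment ℝ a b) :
    (b - q) / (a - q) ∈ Complex.slitPlane := by
  by_contra hs
  have ha : a - q ≠ 0 := by
    intro ha
    exact h (sub_eq_zero.mp ha ▸ left_mem_segment ℝ a b)
  rw [Complex.mem_slitPlane_iff, not_or, not_lt, not_not] at hs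
  obtain ⟨hre, him⟩ := hs
  set r := ((b - q) / (a - q)).re with hr
  have hz : (b - q) / (a - q) = (r : ℂ) := Complex.ext (by simp [hr]) (by simp [him])
  rw [div_eq_iff ha] at hz
  apply h
  have hpos : 0 < 1 - r := by linarith
  refine ⟨-r / (1 - r), 1 / (1 - r), div_nonneg (by linarith) hpos.le, by positivity, ?_, ?_⟩
  · field_simp; ring
  · have hne : (1 - (r : ℂ)) ≠ 0 := by exact_mod_cast hpos.ne'
    rw [Complex.real_smul, Complex.real_smul]
    push_cast
    field_simp
    linear_combination hz

theorem continuousAt_totalTurn {p : ℕ → ℂ} {n : ℕ} {q : ℂ}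
    (hq : ∀ j, q ∉ segment ℝ (p j) (p (j + 1))) : ContinuousAt (totalTurn p n) q := by
  unfold totalTurn
  refine tendsto_finsetSum _ fun j _ => ?_
  have ha : p j - q ≠ 0 := by
    intro ha
    exact hq j (sub_eq_zero.mp ha ▸ left_mem_segment ℝ _ _)
  unfold turnAngle
  have h1 : ContinuousAt (fun z : ℂ => (p (j + 1) - z) / (p j - z)) q :=
    ContinuousAt.div (by fun_prop) (by fun_prop) ha
  exact ContinuousAt.comp (g := Complex.arg) (Complex.continuousAt_arg
    (div_mem_slitPlane_of_notMem_segment (hq j))) h1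

/-- A polygon does not wind around points far away: seen from such a point, all vertices lie in
an open half-plane. -/
theorem totalTurn_eq_zero_of_norm_lt {p : ℕ → ℂ} {n : ℕ} {q : ℂ} (hp : p n = p 0)
    (hq : ∀ j, ‖p j‖ < ‖q‖) : totalTurn p n q = 0 := by
  have hw : ∀ j, 0 < ((p j - q) * (-(starRingEnd ℂ q))).re := by
    intro j
    have h1 : (p j * starRingEnd ℂ q).re ≤ ‖p j‖ * ‖q‖ := by
      have := Complex.re_le_norm (p j * starRingEnd ℂ q)
      rwa [norm_mul, RCLike.norm_conj] at this
    have h2 : (q * starRingEnd ℂ q).re = ‖q‖ * ‖q‖ := by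
      rw [Complex.mul_conj, Complex.ofReal_re, Complex.normSq_eq_norm_sq, sq]
    have h3 : ‖p j‖ * ‖q‖ < ‖q‖ * ‖q‖ :=
      mul_lt_mul_of_pos_right (hq j) ((norm_nonneg _).trans_lt (hq j))
    rw [mul_neg, sub_mul, Complex.neg_re, Complex.sub_re]
    linarith
  have h : ∀ j, ∑ k ∈ Finset.range j, turnAngle (p k - q) (p (k + 1) - q) =
      turnAngle (p 0 - q) (p j - q) := by
    intro j
    induction j with
    | zero => simp [turnAngle_self]
    | succ j ih => rw [Finset.sum_range_succ, ih, turnAngle_add_turnAngle (hw _) (hw _) (hw _)]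
  unfold totalTurn
  rw [h, hp, turnAngle_self]

theorem totalTurn_eq_zero_of_unbounded {p : ℕ → ℂ} {n : ℕ} (hp : p n = p 0) {C : Set ℂ}
    (hC : IsPreconnected C) (hdisj : ∀ q ∈ C, ∀ j, q ∉ segment ℝ (p j) (p (j + 1)))
    (hb : ¬ Bornology.IsBounded C) (hpb : Bornology.IsBounded (Set.range p)) {q : ℂ}
    (hq : q ∈ C) : totalTurn p n q = 0 := by
  obtain ⟨R, hR⟩ := hpb.exists_norm_le
  obtain ⟨q', hq', hRq'⟩ : ∃ q' ∈ C, R < ‖q'‖ := by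
    by_contra! hcon
    exact hb (isBounded_iff_forall_norm_le.mpr ⟨R, hcon⟩)
  have h0 : totalTurn p n q' = 0 :=
    totalTurn_eq_zero_of_norm_lt hp fun j => (hR _ ⟨j, rfl⟩).trans_lt hRq'
  have hcont : ContinuousOn (totalTurn p n) C := fun x hx =>
    (continuousAt_totalTurn (hdisj x hx)).continuousWithinAt
  have hint : ∀ x ∈ C, ∃ m : ℤ, totalTurn p n x = m * (2 * Real.pi) := fun x hx =>
    exists_int_totalTurn_eq hp fun j h => hdisj x hx j (h ▸ left_mem_segment ℝ _ _)
  have hord := (hC.image _ hcont).ordConnected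
  have hpi := Real.pi_pos
  -- no value of `totalTurn` on `C` lies strictly between two multiples of `2π`
  have hno : ∀ x ∈ C, totalTurn p n x ≠ Real.pi ∧ totalTurn p n x ≠ -Real.pi := by
    intro x hx
    obtain ⟨m, hm⟩ := hint x hx
    constructor <;> intro h
    · have h1 : ((2 * m : ℤ) : ℝ) * Real.pi = (1 : ℤ) * Real.pi := by push_cast; linarith
      have h2 := Int.cast_injective (mul_right_cancel₀ hpi.ne' h1)
      omega
    · have h1 : ((2 * m : ℤ) : ℝ) * Real.pi = (-1 : ℤ) * Real.pi := by push_cast; linarith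
      have h2 := Int.cast_injective (mul_right_cancel₀ hpi.ne' h1)
      omega
  obtain ⟨m, hm⟩ := hint q hq
  have hmem := Set.mem_image_of_mem (totalTurn p n) hq
  have hmem' := Set.mem_image_of_mem (totalTurn p n) hq'
  rw [h0] at hmem'
  rcases lt_trichotomy m 0 with hm0 | rfl | hm0
  · exfalso
    have h1 : (m : ℝ) ≤ -1 := by exact_mod_cast (by omega : m ≤ -1)
    obtain ⟨x, hx, hx'⟩ := hord.out hmem hmem' (show -Real.pi ∈ _ from ⟨by nlinarith, by linarith⟩)
    exact (hno x hx).2 hx'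
  · simpa using hm
  · exfalso
    have h1 : (1 : ℝ) ≤ m := by exact_mod_cast hm0
    obtain ⟨x, hx, hx'⟩ := hord.out hmem' hmem (show Real.pi ∈ _ from ⟨hpi.le, by nlinarith⟩)
    exact (hno x hx).1 hx'

theorem sum_Ico_add_of_periodic {n : ℕ} {g : ℕ → ℝ} (hg : ∀ i, g (i + n) = g i) (i : ℕ) :
    ∑ j ∈ Finset.Ico i (i + n), g j = ∑ j ∈ Finset.range n, g j := by
  induction i with
  | zero => rw [zero_add, Finset.range_eq_Ico]
  | succ i ih =>
    rcases Nat.eq_zero_or_pos n with rfl | hn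
    · simp
    · rw [← ih, Finset.sum_eq_sum_Ico_succ_bot (by omega : i < i + n),
        show i + 1 + n = i + n + 1 by omega, Finset.sum_Ico_succ_top (by omega), hg]
      ring

/-- Moving the base point from a vertex of the polygon to `q`, along a segment that meets the
polygon only at the vertex, relates the angle of the polygon at the vertex to the winding number about
`q`. -/
theorem IsSimplePolygon.turnAngle_add_turnAngle_eq {n : ℕ} {p : ℕ → ℂ}
    (P : IsSimplePolygon n p) {i : ℕ} {q : ℂ} (hq : q ≠ p (i + 1))
    (hdisj : ∀ j, i + 2 ≤ j → j < i + n →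
      Disjoint (segment ℝ (p (i + 1)) q) (segment ℝ (p j) (p (j + 1))))
    (hprev : ¬ SameRay ℝ (p i - p (i + 1)) (q - p (i + 1)))
    (hnext : ¬ SameRay ℝ (p (i + 2) - p (i + 1)) (q - p (i + 1))) :
    turnAngle (p i - p (i + 1)) (p (i + 1) - q) +
      turnAngle (p (i + 1) - q) (p (i + 2) - p (i + 1)) =
    edgeAngle p (i + 1) - secantAngle p (i + 1) (i + n) + totalTurn p n q := by
  have hn := P.three_le
  have hb : p (i + 1) - q ≠ 0 := sub_ne_zero.mpr hq.symm
  have ha : p i - p (i + 1) ≠ 0 := sub_ne_zero.mpr (P.ne i (i + 1) (by omega) (by omega))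
  have hc : p (i + 2) - p (i + 1) ≠ 0 :=
    sub_ne_zero.mpr (P.ne (i + 1) (i + 2) (by omega) (by omega)).symm
  have h1 := turnAngle_add_self ha hb (by rwa [neg_sub])
  obtain ⟨w, hcw, hbw⟩ := exists_halfPlane_of_not_sameRay_neg hc hb (by rwa [neg_sub])
  have hcbw : 0 < ((p (i + 2) - p (i + 1) + (p (i + 1) - q)) * w).re := by
    rw [add_mul, Complex.add_re]; exact add_pos hcw hbw
  have h2 := turnAngle_add_turnAngle hbw hcbw hcw
  have h3 := turnAngle_comm_of_halfPlane hcw hcbw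
  rw [sub_add_sub_cancel] at h1 h2 h3
  -- telescoping over the edges that do not contain the vertex
  have htel : ∀ j, i + 2 ≤ j → j ≤ i + n →
      secantAngle p (i + 1) j + turnAngle (p j - p (i + 1)) (p j - q) =
      edgeAngle p (i + 1) + turnAngle (p (i + 2) - p (i + 1)) (p (i + 2) - q) +
        ∑ k ∈ Finset.Ico (i + 2) j, turnAngle (p k - q) (p (k + 1) - q) := by
    intro j hij
    induction j, hij using Nat.le_induction with
    | base => intro _; rw [secantAngle_self_succ]; simp
    | succ j hij ih =>
      intro hj
      rw [secantAngle_succ_right p (by omega), Finset.sum_Ico_succ_top (by omega)]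
      linarith [turnAngle_square (hdisj j hij (by omega)), ih (by omega)]
  have h4 := htel (i + n) (by omega) le_rfl
  have h5 : totalTurn p n q = ∑ k ∈ Finset.Ico i (i + n), turnAngle (p k - q) (p (k + 1) - q) := by
    rw [sum_Ico_add_of_periodic, totalTurn]
    intro k
    rw [P.periodic, show k + n + 1 = k + 1 + n by omega, P.periodic]
  rw [Finset.sum_eq_sum_Ico_succ_bot (by omega),
    Finset.sum_eq_sum_Ico_succ_bot (by omega)] at h5
  rw [P.periodic] at h4
  linarith

/-- If `k` segments with distinct directions lead from the vertex `p (i + 1)` to points `q a` of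
winding number zero, then the polygon leaves at least `k + 1` of the steps of a full turn to the
other side. The orientation of the polygon is not needed: winding number zero puts the directions
of the segments into the right interval for either sign. -/
theorem IsSimplePolygon.abs_angleCount_sub_le {n k : ℕ} {p : ℕ → ℂ} (P : IsSimplePolygon n p)
    {Φ : Finset ℝ} {i : ℕ} {q : Fin k → ℂ} (hk : 0 < k) (hq : ∀ a, q a ≠ p (i + 1))
    (hdisj : ∀ a j, i + 2 ≤ j → j < i + n →
      Disjoint (segment ℝ (p (i + 1)) (q a)) (segment ℝ (p j) (p (j + 1))))
    (hprev : ∀ a, ¬ SameRay ℝ (p i - p (i + 1)) (q a - p (i + 1)))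
    (hnext : ∀ a, ¬ SameRay ℝ (p (i + 2) - p (i + 1)) (q a - p (i + 1)))
    (hinj : ∀ a b, a ≠ b → ¬ SameRay ℝ (q a - p (i + 1)) (q b - p (i + 1)))
    (hturn : ∀ a, totalTurn p n (q a) = 0)
    (hΦq : ∀ a θ, IsAngleOf θ (q a - p (i + 1)) → ∃ φ ∈ Φ, ∃ m : ℤ, θ = φ + m * Real.pi)
    (hΦp : ∀ j θ, IsAngleOf θ (p (j + 1) - p j) → ∃ φ ∈ Φ, ∃ m : ℤ, θ = φ + m * Real.pi) :
    |angleCount Φ (secantAngle p (i + 1) (i + n)) - angleCount Φ (edgeAngle p (i + 1))| ≤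
      2 * Φ.card - (k + 1) := by
  have hn := P.three_le
  have ha : p i - p (i + 1) ≠ 0 := sub_ne_zero.mpr (P.ne i (i + 1) (by omega) (by omega))
  have hb : ∀ a, p (i + 1) - q a ≠ 0 := fun a => sub_ne_zero.mpr (hq a).symm
  have hβ : IsAngleOf (secantAngle p (i + 1) (i + n)) (p i - p (i + 1)) := by
    rw [← P.periodic i]
    exact P.isAngleOf_secantAngle (by omega) (by omega)
  have hα := P.isAngleOf_edgeAngle (i + 1)
  set β := secantAngle p (i + 1) (i + n)
  set α := edgeAngle p (i + 1)
  have hsum : ∀ a, turnAngle (p i - p (i + 1)) (p (i + 1) - q a) +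
      turnAngle (p (i + 1) - q a) (p (i + 2) - p (i + 1)) = α - β := fun a => by
    rw [P.turnAngle_add_turnAngle_eq (hq a) (hdisj a) (hprev a) (hnext a), hturn, add_zero]
  have hl : ∀ a, turnAngle (p i - p (i + 1)) (p (i + 1) - q a) < Real.pi := fun a =>
    lt_of_le_of_ne (turnAngle_le_pi _ _) fun h => hprev a (by
      have := sameRay_neg_of_turnAngle_eq_pi ha h
      rwa [neg_sub] at this)
  have hr : ∀ a, turnAngle (p (i + 1) - q a) (p (i + 2) - p (i + 1)) < Real.pi := fun a =>
    lt_of_le_of_ne (turnAngle_le_pi _ _) fun h => hnext a (by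
      have := (sameRay_neg_of_turnAngle_eq_pi (hb a) h).neg
      rw [neg_neg, neg_sub] at this
      exact this.symm)
  have hl' : ∀ a, -Real.pi < turnAngle (p i - p (i + 1)) (p (i + 1) - q a) := fun a =>
    neg_pi_lt_turnAngle _ _
  have hr' : ∀ a, -Real.pi < turnAngle (p (i + 1) - q a) (p (i + 2) - p (i + 1)) := fun a =>
    neg_pi_lt_turnAngle _ _
  have hψ : ∀ a, IsAngleOf (β + turnAngle (p i - p (i + 1)) (p (i + 1) - q a) + Real.pi)
      (q a - p (i + 1)) := fun a => by
    have := (hβ.add_turnAngle (b := p (i + 1) - q a) ha).neg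
    rwa [neg_sub] at this
  have hβΦ : ∃ φ ∈ Φ, ∃ m : ℤ, β = φ + m * Real.pi := by
    have := hβ.neg
    rw [neg_sub] at this
    obtain ⟨φ, hφ, m, hm⟩ := hΦp i _ this
    exact ⟨φ, hφ, m - 1, by push_cast; linarith⟩
  refine abs_angleCount_sub_le_of_between
    (ψ := fun a => β + turnAngle (p i - p (i + 1)) (p (i + 1) - q a) + Real.pi)
    ?_ (fun a => hΦq a _ (hψ a)) (hΦp _ _ hα) hβΦ ?_ ?_ ?_ ?_
  · intro a b hab
    by_contra hne
    refine hinj a b hne ((hψ a).sameRay ?_)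
    simp only at hab
    rw [hab]
    exact hψ b
  · intro a
    constructor <;> linarith [hsum a, hl a, hr a, hl' a, hr' a]
  · intro a
    constructor <;> linarith [hsum a, hl a, hr a, hl' a, hr' a]
  · linarith [hsum ⟨0, hk⟩, hl' ⟨0, hk⟩, hr' ⟨0, hk⟩]
  · linarith [hsum ⟨0, hk⟩, hl ⟨0, hk⟩, hr ⟨0, hk⟩]

/-! ### Slopes and outer faces of straight-line drawings -/

/-- The identification of the plane with `ℂ`. -/
noncomputable abbrev planeToComplex : Plane ≃ₗᵢ[ℝ] ℂ := Complex.orthonormalBasisOneI.repr.symm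

theorem planeToComplex_image_segment (a b : Plane) :
    planeToComplex '' segment ℝ a b = segment ℝ (planeToComplex a) (planeToComplex b) :=
  image_segment ℝ planeToComplex.toLinearEquiv.toLinearMap.toAffineMap a b

namespace StraightLineDrawing

variable {V : Type*} {G : SimpleGraph V}

theorem exists_smul_eq_of_slope_eq (D : StraightLineDrawing G) {u v x y : V}
    (h : D.slope u v = D.slope x y) :
    ∃ r : ℝ, r • (D.pos y - D.pos x) = D.pos v - D.pos u := by
  have h1 : affineSpan ℝ {D.pos u, D.pos v} ∈ D.slope x y := by
    rw [← h]
    exact AffineSubspace.Parallel.refl _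
  exact AffineSubspace.direction_affineSpan_pair_le_iff_exists_smul.mp h1.direction_eq.le

theorem slopes_finite [Finite V] (D : StraightLineDrawing G) : D.slopes.Finite := by
  refine (Set.finite_range fun e : V × V => D.slope e.1 e.2).subset ?_
  rintro _ ⟨u, v, _, rfl⟩
  exact ⟨(u, v), rfl⟩

/-- Two edges at a common vertex point in different directions. -/
theorem not_sameRay (D : StraightLineDrawing G) {u v w : V} (hv : G.Adj u v) (hw : G.Adj u w)
    (hvw : v ≠ w) : ¬ SameRay ℝ (D.pos v - D.pos u) (D.pos w - D.pos u) := by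
  intro h
  have hne : ∀ {x}, G.Adj u x → D.pos x - D.pos u ≠ 0 := fun hx =>
    sub_ne_zero.mpr fun h => hx.ne (D.pos_injective h).symm
  obtain ⟨r, hr, hrv⟩ := h.exists_pos_left (hne hv) (hne hw)
  rcases le_total r 1 with h1 | h1
  · have hmem : D.pos w ∈ segment ℝ (D.pos u) (D.pos v) := by
      rw [segment_eq_image']
      exact ⟨r, ⟨hr.le, h1⟩, by simp [hrv]⟩
    rcases D.eq_or_eq_of_mem_segment u v w hv hmem with h | h
    · exact hw.ne h.symm
    · exact hvw h.symm
  · have hmem : D.pos v ∈ segment ℝ (D.pos u) (D.pos w) := by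
      rw [segment_eq_image']
      refine ⟨r⁻¹, ⟨by positivity, inv_le_one_of_one_le₀ h1⟩, ?_⟩
      simp [← hrv, smul_smul, hr.ne']
    rcases D.eq_or_eq_of_mem_segment u w v hw hmem with h | h
    · exact hv.ne h.symm
    · exact hvw h

theorem not_sameRay_planeToComplex (D : StraightLineDrawing G) {u v w : V} (hv : G.Adj u v)
    (hw : G.Adj u w) (hvw : v ≠ w) :
    ¬ SameRay ℝ (planeToComplex (D.pos v) - planeToComplex (D.pos u))
      (planeToComplex (D.pos w) - planeToComplex (D.pos u)) := by
  intro h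
  rw [← map_sub, ← map_sub] at h
  exact D.not_sameRay hv hw hvw
    ((SameRay.sameRay_map_iff planeToComplex.toLinearEquiv).mp h)

/-- Choosing one angle for each slope represents all edge angles modulo `π`. -/
theorem exists_angles (D : StraightLineDrawing G) {s : ℕ} (hs : D.slopes.encard = s) :
    ∃ Φ : Finset ℝ, Φ.card ≤ s ∧ ∀ u v, G.Adj u v → ∀ θ,
      IsAngleOf θ (planeToComplex (D.pos v) - planeToComplex (D.pos u)) →
      ∃ φ ∈ Φ, ∃ m : ℤ, θ = φ + m * Real.pi := by
  classical
  have hfin : D.slopes.Finite := Set.finite_of_encard_eq_coe hs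
  have key : ∀ σ ∈ hfin.toFinset, ∃ φ : ℝ, ∀ u v, G.Adj u v → σ = D.slope u v → ∀ θ,
      IsAngleOf θ (planeToComplex (D.pos v) - planeToComplex (D.pos u)) →
      ∃ m : ℤ, θ = φ + m * Real.pi := by
    intro σ hσ
    obtain ⟨x, y, hxy, rfl⟩ := hfin.mem_toFinset.mp hσ
    refine ⟨(planeToComplex (D.pos y) - planeToComplex (D.pos x)).arg, fun u v huv h θ hθ => ?_⟩
    obtain ⟨r, hr⟩ := D.exists_smul_eq_of_slope_eq h.symm
    have hne : ∀ {x y}, G.Adj x y → D.pos y - D.pos x ≠ 0 := fun hx =>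
      sub_ne_zero.mpr fun h => hx.ne (D.pos_injective h).symm
    have hr0 : r ≠ 0 := by
      rintro rfl
      rw [zero_smul] at hr
      exact hne huv hr.symm
    refine hθ.eq_add_int_mul_pi (isAngleOf_arg _) ?_ hr0 ?_
    · rw [← map_sub, Ne, map_eq_zero_iff _ planeToComplex.injective]
      exact hne hxy
    · rw [← map_sub, ← map_sub, ← hr, map_smul, Complex.real_smul]
  choose! g hg using key
  refine ⟨hfin.toFinset.image g, ?_, fun u v huv θ hθ => ?_⟩
  · refine Finset.card_image_le.trans ?_
    rw [hfin.encard_eq_coe_toFinset_card] at hs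
    exact_mod_cast hs.le
  · have hmem : D.slope u v ∈ hfin.toFinset := hfin.mem_toFinset.mpr ⟨u, v, huv, rfl⟩
    obtain ⟨m, hm⟩ := hg _ hmem u v huv rfl θ hθ
    exact ⟨_, Finset.mem_image_of_mem g hmem, m, hm⟩

theorem IsPlanar.disjoint {D : StraightLineDrawing G} (hD : D.IsPlanar) {u v x y : V}
    (huv : G.Adj u v) (hxy : G.Adj x y) (h1 : u ≠ x) (h2 : u ≠ y) (h3 : v ≠ x) (h4 : v ≠ y) :
    Disjoint (segment ℝ (planeToComplex (D.pos u)) (planeToComplex (D.pos v)))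
      (segment ℝ (planeToComplex (D.pos x)) (planeToComplex (D.pos y))) := by
  rw [← planeToComplex_image_segment, ← planeToComplex_image_segment]
  refine (Set.disjoint_image_iff planeToComplex.injective).mpr
    (Set.disjoint_left.mpr fun p hp hp' => ?_)
  have hne : s(u, v) ≠ s(x, y) := by
    rw [Ne, Sym2.eq_iff]
    tauto
  obtain ⟨w, hw, hw', -⟩ := hD u v x y huv hxy hne p hp hp'
  rcases hw with rfl | rfl <;> rcases hw' with rfl | rfl <;> contradiction

/-- A closed polygon of edges of the drawing does not wind around points in the closure of the
outer face. -/
theorem totalTurn_eq_zero_of_mem_closure_outerFace (D : StraightLineDrawing G) {c : ℕ → V} {n : ℕ}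
    (hc : ∀ j, G.Adj (c j) (c (j + 1))) (hcn : c n = c 0) (hfin : (Set.range c).Finite) {x : Plane}
    (hx : x ∈ closure D.outerFace)
    (hxc : ∀ j, planeToComplex x ∉
      segment ℝ (planeToComplex (D.pos (c j))) (planeToComplex (D.pos (c (j + 1))))) :
    totalTurn (fun j => planeToComplex (D.pos (c j))) n (planeToComplex x) = 0 := by
  have h0 : ∀ y ∈ D.outerFace,
      totalTurn (fun j => planeToComplex (D.pos (c j))) n (planeToComplex y) = 0 := by
    rintro y ⟨hy, hyb⟩
    refine totalTurn_eq_zero_of_unbounded (by simp only [hcn])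
      (isPreconnected_connectedComponentIn.image _ planeToComplex.continuous.continuousOn)
      ?_ ?_ ?_ (Set.mem_image_of_mem _ (mem_connectedComponentIn hy))
    · rintro _ ⟨z, hz, rfl⟩ j hmem
      rw [← planeToComplex_image_segment] at hmem
      obtain ⟨z', hz', h⟩ := hmem
      rw [planeToComplex.injective h] at hz'
      exact connectedComponentIn_subset _ _ hz (Or.inr ⟨_, _, hc j, hz'⟩)
    · intro hb
      apply hyb
      obtain ⟨R, hR⟩ := hb.exists_norm_le
      refine isBounded_iff_forall_norm_le.mpr ⟨R, fun z hz => ?_⟩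
      exact (planeToComplex.norm_map z).symm.trans_le (hR _ (Set.mem_image_of_mem _ hz))
    · have : (Set.range fun j => planeToComplex (D.pos (c j))) =
          (fun v => planeToComplex (D.pos v)) '' Set.range c := by
        rw [← Set.range_comp]; rfl
      rw [this]
      exact (hfin.image _).isBounded
  have hcont := (continuousAt_totalTurn (n := n) hxc).comp planeToComplex.continuous.continuousAt
  exact tendsto_nhds_unique_of_frequently_eq hcont tendsto_const_nhds
    ((mem_closure_iff_frequently.mp hx).mono h0)

end StraightLineDrawing

/-! ### The lower bound for cycles with pendants -/

theorem cycleGraph_adj_iff {n : ℕ} (hn : 3 ≤ n) (u v : Fin n) :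
    (SimpleGraph.cycleGraph n).Adj u v ↔
      v.val = (u.val + 1) % n ∨ u.val = (v.val + 1) % n := by
  rw [SimpleGraph.cycleGraph_adj', Fin.val_sub, Fin.val_sub]
  have key : ∀ a b : ℕ, a < n → b < n → ((n - b + a) % n = 1 ↔ a = (b + 1) % n) := by
    intro a b ha hb
    rcases Nat.lt_or_ge a b with h | h
    · rw [Nat.mod_eq_of_lt (by omega)]
      rcases Nat.lt_or_ge (b + 1) n with h' | h'
      · rw [Nat.mod_eq_of_lt h']; omega
      · rw [show b + 1 = n by omega, Nat.mod_self]; omega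
    · rw [show n - b + a = (a - b) + n by omega, Nat.add_mod_right, Nat.mod_eq_of_lt (by omega)]
      rcases Nat.lt_or_ge (b + 1) n with h' | h'
      · rw [Nat.mod_eq_of_lt h']; omega
      · rw [show b + 1 = n by omega, Nat.mod_self]; omega
  rw [key _ _ u.isLt v.isLt, key _ _ v.isLt u.isLt, or_comm]

/-- The vertices of the cycle, enumerated periodically. -/
def cycleVertex (k : ℕ) {n : ℕ} (hn : 0 < n) (i : ℕ) : Fin n ⊕ Fin n × Fin k :=
  Sum.inl ⟨i % n, Nat.mod_lt i hn⟩

theorem cycleVertex_ne {k n : ℕ} (hn : 0 < n) {i j : ℕ} (hij : i < j) (hj : j < i + n) :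
    cycleVertex k hn i ≠ cycleVertex k hn j := by
  intro h
  have h1 : i % n = j % n := congrArg Fin.val (Sum.inl_injective h)
  have h2 := Nat.le_of_dvd (by omega) ((Nat.modEq_iff_dvd' hij.le).mp h1)
  omega

theorem cycleVertex_add {k n : ℕ} (hn : 0 < n) (i : ℕ) :
    cycleVertex k hn (i + n) = cycleVertex k hn i := by
  simp [cycleVertex]

theorem adj_cycleVertex {k n : ℕ} (hn : 3 ≤ n) (i : ℕ) :
    (cycleWithPendants n k).Adj (cycleVertex k (by omega : 0 < n) i)
      (cycleVertex k (by omega) (i + 1)) := by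
  refine (cycleGraph_adj_iff hn _ _).mpr (Or.inl ?_)
  simp

theorem isSimplePolygon_cycle {n k : ℕ} (hn : 3 ≤ n)
    {D : StraightLineDrawing (cycleWithPendants n k)} (hD : D.IsPlanar) :
    IsSimplePolygon n fun i => planeToComplex (D.pos (cycleVertex k (by omega : 0 < n) i)) where
  three_le := hn
  periodic i := by rw [cycleVertex_add]
  ne i j hij hj h := cycleVertex_ne _ hij hj (D.pos_injective (planeToComplex.injective h))
  disjoint i j hij hj := by
    refine hD.disjoint (adj_cycleVertex hn i) (adj_cycleVertex hn j) ?_ ?_ ?_ ?_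
    · exact cycleVertex_ne _ (by omega) (by omega)
    · exact cycleVertex_ne _ (by omega) (by omega)
    · exact cycleVertex_ne _ (by omega) (by omega)
    · exact cycleVertex_ne _ (by omega) (by omega)

/-- The pendants are the segments that leave the cycle into the region of winding number zero, their
ends being on the boundary of the outer face. -/
theorem mul_le_mul_of_encard_slopes {n k s : ℕ} (hn : 3 ≤ n) (hk : 0 < k)
    {D : StraightLineDrawing (cycleWithPendants n k)} (hD : D.IsOuterplanar)
    (hs : D.slopes.encard = s) : n * (k + 1) ≤ (n + 2) * s := by
  obtain ⟨hplanar, hface⟩ := hD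
  have hn0 : 0 < n := by omega
  obtain ⟨Φ, hcard, hΦ⟩ := D.exists_angles hs
  refine le_trans ?_ (Nat.mul_le_mul_left (n + 2) hcard)
  have P := isSimplePolygon_cycle hn hplanar
  refine P.mul_le_mul_card fun i => ?_
  have hadj : ∀ a, (cycleWithPendants n k).Adj (cycleVertex k hn0 (i + 1))
      (Sum.inr (⟨(i + 1) % n, Nat.mod_lt _ hn0⟩, a)) := fun a => rfl
  refine P.abs_angleCount_sub_le
    (q := fun a => planeToComplex (D.pos (Sum.inr (⟨(i + 1) % n, Nat.mod_lt _ hn0⟩, a))))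
    hk ?_ ?_ ?_ ?_ ?_ ?_ ?_ ?_
  · intro a h
    exact Sum.inr_ne_inl (D.pos_injective (planeToComplex.injective h))
  · intro a j hij hj
    refine hplanar.disjoint (hadj a) (adj_cycleVertex hn j) ?_ ?_ ?_ ?_
    · exact cycleVertex_ne _ (by omega) (by omega)
    · exact cycleVertex_ne _ (by omega) (by omega)
    · exact Sum.inr_ne_inl
    · exact Sum.inr_ne_inl
  · intro a
    exact D.not_sameRay_planeToComplex (adj_cycleVertex hn i).symm (hadj a) Sum.inl_ne_inr
  · intro a
    exact D.not_sameRay_planeToComplex (adj_cycleVertex hn (i + 1)) (hadj a) Sum.inl_ne_inr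
  · intro a b hab
    refine D.not_sameRay_planeToComplex (hadj a) (hadj b) fun h => hab ?_
    exact congrArg Prod.snd (Sum.inr_injective h)
  · intro a
    refine D.totalTurn_eq_zero_of_mem_closure_outerFace (adj_cycleVertex hn) ?_
      (Set.toFinite _) (frontier_subset_closure (hface _)) ?_
    · simpa using cycleVertex_add (k := k) hn0 0
    · intro j hmem
      rw [← planeToComplex_image_segment] at hmem
      obtain ⟨x, hx, h⟩ := hmem
      rw [planeToComplex.injective h] at hx
      rcases D.eq_or_eq_of_mem_segment _ _ _ (adj_cycleVertex hn j) hx with h | h <;>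
        exact Sum.inr_ne_inl h
  · intro a θ hθ
    exact hΦ _ _ (hadj a) θ hθ
  · intro j θ hθ
    exact hΦ _ _ (adj_cycleVertex hn j) θ hθ

/-! ### An outerplanar drawing of cycles with pendants -/

theorem plane_ext {p q : Plane} (h0 : p 0 = q 0) (h1 : p 1 = q 1) : p = q := by
  ext i
  fin_cases i
  · exact h0
  · exact h1

theorem exists_coords_of_mem_segment {a b p : Plane} (h : p ∈ segment ℝ a b) :
    ∃ t : ℝ, 0 ≤ t ∧ t ≤ 1 ∧ p 0 = a 0 + t * (b 0 - a 0) ∧ p 1 = a 1 + t * (b 1 - a 1) := by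
  rw [segment_eq_image'] at h
  obtain ⟨t, ⟨h0, h1⟩, rfl⟩ := h
  exact ⟨t, h0, h1, by simp, by simp⟩

/-- The cycle vertex `i` is placed at the point `(i, i²)` of the standard parabola and its
pendants on the line `y = -1`, at most `1 / 2` to the right of it. -/
noncomputable def parabolaPos {n k : ℕ} : Fin n ⊕ Fin n × Fin k → Plane
  | Sum.inl i => !₂[(i : ℝ), (i : ℝ) ^ 2]
  | Sum.inr b => !₂[(b.1 : ℝ) + (b.2 : ℝ) / (2 * (k + 1)), -1]

/-- An orientation of the edges of the cycle with pendants: the edges between consecutive points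
of the parabola, the edge closing the cycle, and the pendant edges. -/
inductive IsArc {n k : ℕ} : Fin n ⊕ Fin n × Fin k → Fin n ⊕ Fin n × Fin k → Prop
  | step (i j : Fin n) (h : i.val + 1 = j.val) : IsArc (Sum.inl i) (Sum.inl j)
  | close (i j : Fin n) (hi : i.val = 0) (hj : j.val + 1 = n) : IsArc (Sum.inl i) (Sum.inl j)
  | pendant (i : Fin n) (a : Fin k) : IsArc (Sum.inl i) (Sum.inr (i, a))

section

variable {n k : ℕ}

theorem offset_nonneg (a : Fin k) : 0 ≤ (a : ℝ) / (2 * (k + 1)) := by positivity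

theorem offset_le_half (a : Fin k) : (a : ℝ) / (2 * (k + 1)) ≤ 1 / 2 := by
  have h : (a : ℝ) ≤ k := by exact_mod_cast a.isLt.le
  rw [div_le_div_iff₀ (by positivity) (by norm_num)]
  linarith

theorem offset_injective {a b : Fin k} (h : (a : ℝ) / (2 * (k + 1)) = (b : ℝ) / (2 * (k + 1))) :
    a = b := by
  have hk : (2 * ((k : ℝ) + 1)) ≠ 0 := by positivity
  rw [div_left_inj' hk] at h
  exact Fin.ext (by exact_mod_cast h)

theorem eq_of_natCast_add_eq {i j : ℕ} {s t : ℝ} (hs : 0 ≤ s) (hs' : s ≤ 1 / 2) (ht : 0 ≤ t)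
    (ht' : t ≤ 1 / 2) (h : (i : ℝ) + s = j + t) : i = j := by
  rcases lt_trichotomy i j with hij | hij | hij
  · have : (i : ℝ) + 1 ≤ j := by exact_mod_cast hij
    linarith
  · exact hij
  · have : (j : ℝ) + 1 ≤ i := by exact_mod_cast hij
    linarith

theorem parabolaPos_injective : Function.Injective (parabolaPos (n := n) (k := k)) := by
  rintro (i | ⟨i, a⟩) (j | ⟨j, b⟩) h
  · have h0 := congrFun (congrArg WithLp.ofLp h) 0
    simp only [parabolaPos, PiLp.toLp_apply, Matrix.cons_val_zero] at h0
    exact congrArg _ (Fin.ext (by exact_mod_cast h0))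
  · have h1 := congrFun (congrArg WithLp.ofLp h) 1
    simp only [parabolaPos, PiLp.toLp_apply, Matrix.cons_val_one, Matrix.cons_val_zero] at h1
    nlinarith [sq_nonneg (i : ℝ)]
  · have h1 := congrFun (congrArg WithLp.ofLp h) 1
    simp only [parabolaPos, PiLp.toLp_apply, Matrix.cons_val_one, Matrix.cons_val_zero] at h1
    nlinarith [sq_nonneg (j : ℝ)]
  · have h0 := congrFun (congrArg WithLp.ofLp h) 0
    simp only [parabolaPos, PiLp.toLp_apply, Matrix.cons_val_zero] at h0
    obtain rfl : i = j := Fin.ext (eq_of_natCast_add_eq (offset_nonneg a) (offset_le_half a)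
      (offset_nonneg b) (offset_le_half b) h0)
    rw [offset_injective (add_left_cancel h0)]

theorem coords_of_mem_step {i j : Fin n} (h : i.val + 1 = j.val) {p : Plane}
    (hp : p ∈ segment ℝ (parabolaPos (k := k) (Sum.inl i)) (parabolaPos (k := k) (Sum.inl j))) :
    ∃ t : ℝ, 0 ≤ t ∧ t ≤ 1 ∧ p 0 = i + t ∧ p 1 = (i : ℝ) ^ 2 + (2 * i + 1) * t := by
  obtain ⟨t, h0, h1, hx, hy⟩ := exists_coords_of_mem_segment hp
  have hj : (j : ℝ) = i + 1 := by exact_mod_cast h.symm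
  simp only [parabolaPos, PiLp.toLp_apply, Matrix.cons_val_zero, Matrix.cons_val_one, hj] at hx hy
  exact ⟨t, h0, h1, by linarith, by linarith⟩

theorem coords_of_mem_close {i j : Fin n} (hi : i.val = 0) (hj : j.val + 1 = n) {p : Plane}
    (hp : p ∈ segment ℝ (parabolaPos (k := k) (Sum.inl i)) (parabolaPos (k := k) (Sum.inl j))) :
    0 ≤ p 0 ∧ p 0 ≤ n - 1 ∧ p 1 = (n - 1) * p 0 := by
  obtain ⟨t, h0, h1, hx, hy⟩ := exists_coords_of_mem_segment hp
  have hj' : (j : ℝ) = n - 1 := by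
    have : (j : ℝ) + 1 = n := by exact_mod_cast hj
    linarith
  have hn : (0 : ℝ) ≤ n - 1 := by rw [← hj']; positivity
  have hi' : (i : ℝ) = 0 := by exact_mod_cast hi
  simp only [parabolaPos, PiLp.toLp_apply, Matrix.cons_val_zero, Matrix.cons_val_one, hj',
    hi'] at hx hy
  refine ⟨by rw [hx]; nlinarith, by rw [hx]; nlinarith, by rw [hx, hy]; ring⟩

theorem coords_of_mem_pendant {i : Fin n} {a : Fin k} {p : Plane}
    (hp : p ∈ segment ℝ (parabolaPos (k := k) (Sum.inl i)) (parabolaPos (Sum.inr (i, a)))) :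
    ∃ t : ℝ, 0 ≤ t ∧ t ≤ 1 ∧ p 0 = i + t * ((a : ℝ) / (2 * (k + 1))) ∧
      p 1 = (i : ℝ) ^ 2 - t * ((i : ℝ) ^ 2 + 1) := by
  obtain ⟨t, h0, h1, hx, hy⟩ := exists_coords_of_mem_segment hp
  simp only [parabolaPos, PiLp.toLp_apply, Matrix.cons_val_zero, Matrix.cons_val_one] at hx hy
  exact ⟨t, h0, h1, by linarith, by linarith⟩

theorem eq_parabolaPos_inl {i : Fin n} {p : Plane} (h0 : p 0 = i) (h1 : p 1 = (i : ℝ) ^ 2) :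
    p = parabolaPos (k := k) (Sum.inl i) := by
  apply plane_ext <;> simpa [parabolaPos]

theorem step_meets_step {i j i' j' : Fin n} (h : i.val + 1 = j.val) (h' : i'.val + 1 = j'.val)
    (hii : i.val < i'.val) {p : Plane}
    (hp : p ∈ segment ℝ (parabolaPos (k := k) (Sum.inl i)) (parabolaPos (k := k) (Sum.inl j)))
    (hp' : p ∈ segment ℝ (parabolaPos (k := k) (Sum.inl i')) (parabolaPos (k := k) (Sum.inl j'))) :
    j = i' ∧ p = parabolaPos (k := k) (Sum.inl i') := by
  obtain ⟨t, h0, h1, hx, hy⟩ := coords_of_mem_step h hp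
  obtain ⟨t', h0', h1', hx', hy'⟩ := coords_of_mem_step h' hp'
  have hle : (i : ℝ) + 1 ≤ i' := by exact_mod_cast hii
  have ht' : t' = 0 := by linarith
  have hi' : i.val + 1 = i'.val := by
    by_contra hne
    have : (i : ℝ) + 2 ≤ i' := by exact_mod_cast (by omega : i.val + 2 ≤ i'.val)
    linarith
  refine ⟨Fin.ext (by omega), eq_parabolaPos_inl ?_ ?_⟩
  · rw [hx', ht', add_zero]
  · rw [hy', ht', mul_zero, add_zero]

theorem step_meets_close (hn : 3 ≤ n) {i j i' j' : Fin n} (h : i.val + 1 = j.val)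
    (hi' : i'.val = 0) (hj' : j'.val + 1 = n) {p : Plane}
    (hp : p ∈ segment ℝ (parabolaPos (k := k) (Sum.inl i)) (parabolaPos (k := k) (Sum.inl j)))
    (hp' : p ∈ segment ℝ (parabolaPos (k := k) (Sum.inl i')) (parabolaPos (k := k) (Sum.inl j'))) :
    (i = i' ∧ p = parabolaPos (k := k) (Sum.inl i')) ∨
      (j = j' ∧ p = parabolaPos (k := k) (Sum.inl j')) := by
  obtain ⟨t, h0, h1, hx, hy⟩ := coords_of_mem_step h hp
  obtain ⟨-, -, hy'⟩ := coords_of_mem_close hi' hj' hp'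
  have hin : (i : ℝ) + 2 ≤ n := by exact_mod_cast (by omega : i.val + 2 ≤ n)
  have hi0 : (0 : ℝ) ≤ i := by positivity
  -- the closing edge is above both end-points of the step
  have hsum : (1 - t) * ((i : ℝ) * (n - 1 - i)) + t * (((i : ℝ) + 1) * (n - 2 - i)) = 0 := by
    rw [hx, hy] at hy'
    linarith
  have hA : 0 ≤ (1 - t) * ((i : ℝ) * (n - 1 - i)) :=
    mul_nonneg (by linarith) (mul_nonneg hi0 (by linarith))
  have hB : 0 ≤ t * (((i : ℝ) + 1) * (n - 2 - i)) :=
    mul_nonneg h0 (mul_nonneg (by linarith) (by linarith))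
  have hA0 : (1 - t) * ((i : ℝ) * (n - 1 - i)) = 0 := by linarith
  have hB0 : t * (((i : ℝ) + 1) * (n - 2 - i)) = 0 := by linarith
  rcases mul_eq_zero.mp hB0 with ht | hB0
  · left
    subst ht
    rw [sub_zero, one_mul, mul_eq_zero] at hA0
    rcases hA0 with hi | hi
    · have hi : i.val = 0 := by exact_mod_cast hi
      obtain rfl : i = i' := Fin.ext (by omega)
      exact ⟨rfl, eq_parabolaPos_inl (by linarith) (by linarith)⟩
    · linarith
  · have hi2 : (i : ℝ) + 2 = n := by
      rcases mul_eq_zero.mp hB0 with h | h <;> linarith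
    have hi2' : i.val + 2 = n := by exact_mod_cast hi2
    right
    obtain rfl : j = j' := Fin.ext (by omega)
    have hi1 : (1 : ℝ) ≤ i := by exact_mod_cast (by omega : 1 ≤ i.val)
    have ht : t = 1 := by
      rcases mul_eq_zero.mp hA0 with h | h
      · linarith
      · rcases mul_eq_zero.mp h with h | h <;> linarith
    have hj : (j : ℝ) = i + 1 := by exact_mod_cast h.symm
    refine ⟨rfl, eq_parabolaPos_inl ?_ ?_⟩
    · rw [hx, ht, hj]
    · rw [hy, ht, hj]; ring

theorem pendant_meets_step {i i' j' : Fin n} {a : Fin k} (h : i'.val + 1 = j'.val) {p : Plane}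
    (hp : p ∈ segment ℝ (parabolaPos (k := k) (Sum.inl i)) (parabolaPos (Sum.inr (i, a))))
    (hp' : p ∈ segment ℝ (parabolaPos (k := k) (Sum.inl i')) (parabolaPos (k := k) (Sum.inl j'))) :
    (i = i' ∨ i = j') ∧ p = parabolaPos (k := k) (Sum.inl i) := by
  obtain ⟨t, h0, h1, hx, hy⟩ := coords_of_mem_pendant hp
  obtain ⟨t', h0', h1', hx', hy'⟩ := coords_of_mem_step h hp'
  have ha := offset_nonneg a
  have ha' := offset_le_half a
  set δ := (a : ℝ) / (2 * (k + 1))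
  have hδ0 : 0 ≤ t * δ := mul_nonneg h0 ha
  have hδ1 : t * δ ≤ 1 / 2 := by nlinarith
  have hi0 : (0 : ℝ) ≤ i := by positivity
  have hi0' : (0 : ℝ) ≤ i' := by positivity
  rcases lt_trichotomy i.val i'.val with hlt | heq | hgt
  · have : (i : ℝ) + 1 ≤ i' := by exact_mod_cast hlt
    linarith
  · have hr : (i : ℝ) = i' := by exact_mod_cast heq
    rw [← hr] at hy'
    have ht : t = 0 := by
      have h2 : 0 ≤ (2 * (i : ℝ) + 1) * t' := by positivity
      have h3 : 0 ≤ t * (i : ℝ) ^ 2 := by positivity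
      linarith
    exact ⟨Or.inl (Fin.ext heq), eq_parabolaPos_inl (by rw [hx, ht]; ring) (by rw [hy, ht]; ring)⟩
  · have h2 : (i' : ℝ) + 1 ≤ i := by exact_mod_cast hgt
    have ht' : t' = 1 := by linarith
    have hie : (i : ℝ) = i' + 1 := by linarith
    have hie' : i.val = i'.val + 1 := by exact_mod_cast hie
    refine ⟨Or.inr (Fin.ext (by omega)), eq_parabolaPos_inl (by linarith) ?_⟩
    rw [hy', ht', hie]; ring

theorem pendant_meets_close {i i' j' : Fin n} {a : Fin k} (hi' : i'.val = 0)
    (hj' : j'.val + 1 = n) {p : Plane}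
    (hp : p ∈ segment ℝ (parabolaPos (k := k) (Sum.inl i)) (parabolaPos (Sum.inr (i, a))))
    (hp' : p ∈ segment ℝ (parabolaPos (k := k) (Sum.inl i')) (parabolaPos (k := k) (Sum.inl j'))) :
    (i = i' ∨ i = j') ∧ p = parabolaPos (k := k) (Sum.inl i) := by
  obtain ⟨t, h0, h1, hx, hy⟩ := coords_of_mem_pendant hp
  obtain ⟨-, -, hy'⟩ := coords_of_mem_close hi' hj' hp'
  have ha := offset_nonneg a
  set δ := (a : ℝ) / (2 * (k + 1))
  have hδ0 : 0 ≤ t * δ := mul_nonneg h0 ha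
  have hi0 : (0 : ℝ) ≤ i := by positivity
  have hin : (i : ℝ) + 1 ≤ n := by exact_mod_cast i.isLt
  have h2 : 0 ≤ ((n : ℝ) - 1) * (t * δ) := mul_nonneg (by linarith) hδ0
  have h3 : 0 ≤ t * (i : ℝ) ^ 2 := by positivity
  have h4 : 0 ≤ (i : ℝ) * (n - 1 - i) := mul_nonneg hi0 (by linarith)
  rw [hx, hy] at hy'
  have ht : t = 0 := by linarith
  subst ht
  refine ⟨?_, eq_parabolaPos_inl (by linarith) (by linarith)⟩
  have h5 : (i : ℝ) * (n - 1 - i) = 0 := by linarith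
  rcases mul_eq_zero.mp h5 with h | h
  · left
    have : i.val = 0 := by exact_mod_cast h
    exact Fin.ext (by omega)
  · right
    have : i.val + 1 = n := by
      have : (i : ℝ) + 1 = n := by linarith
      exact_mod_cast this
    exact Fin.ext (by omega)

theorem pendant_meets_pendant {i j : Fin n} {a b : Fin k} (hne : (i, a) ≠ (j, b)) {p : Plane}
    (hp : p ∈ segment ℝ (parabolaPos (k := k) (Sum.inl i)) (parabolaPos (Sum.inr (i, a))))
    (hp' : p ∈ segment ℝ (parabolaPos (k := k) (Sum.inl j)) (parabolaPos (Sum.inr (j, b)))) :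
    i = j ∧ p = parabolaPos (k := k) (Sum.inl i) := by
  obtain ⟨t, h0, h1, hx, hy⟩ := coords_of_mem_pendant hp
  obtain ⟨t', h0', h1', hx', hy'⟩ := coords_of_mem_pendant hp'
  have ha := offset_nonneg a
  have ha' := offset_le_half a
  have hb := offset_nonneg b
  have hb' := offset_le_half b
  obtain rfl : i = j := Fin.ext (eq_of_natCast_add_eq (mul_nonneg h0 ha) (by nlinarith)
    (mul_nonneg h0' hb) (by nlinarith) (hx.symm.trans hx'))
  have htt : t = t' := by
    have h2 : (t - t') * ((i : ℝ) ^ 2 + 1) = 0 := by linarith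
    rcases mul_eq_zero.mp h2 with h | h
    · linarith
    · nlinarith [sq_nonneg (i : ℝ)]
  subst htt
  have ht : t = 0 := by
    by_contra ht
    apply hne
    rw [offset_injective (mul_left_cancel₀ ht (add_left_cancel (hx.symm.trans hx')))]
  subst ht
  exact ⟨rfl, eq_parabolaPos_inl (by linarith) (by linarith)⟩

theorem IsArc.meets (hn : 3 ≤ n) {u v x y : Fin n ⊕ Fin n × Fin k} (h : IsArc u v)
    (h' : IsArc x y) (hne : s(u, v) ≠ s(x, y)) {p : Plane}
    (hp : p ∈ segment ℝ (parabolaPos u) (parabolaPos v))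
    (hp' : p ∈ segment ℝ (parabolaPos x) (parabolaPos y)) :
    ∃ w, (w = u ∨ w = v) ∧ (w = x ∨ w = y) ∧ p = parabolaPos w := by
  cases h with
  | step i j h =>
    cases h' with
    | step i' j' h' =>
      rcases lt_trichotomy i.val i'.val with hlt | heq | hgt
      · obtain ⟨rfl, hw⟩ := step_meets_step h h' hlt hp hp'
        exact ⟨_, Or.inr rfl, Or.inl rfl, hw⟩
      · obtain rfl := Fin.ext heq
        obtain rfl : j = j' := Fin.ext (by omega)
        exact absurd rfl hne
      · obtain ⟨rfl, hw⟩ := step_meets_step h' h hgt hp' hp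
        exact ⟨_, Or.inl rfl, Or.inr rfl, hw⟩
    | close i' j' hi' hj' =>
      rcases step_meets_close hn h hi' hj' hp hp' with ⟨rfl, hw⟩ | ⟨rfl, hw⟩
      · exact ⟨_, Or.inl rfl, Or.inl rfl, hw⟩
      · exact ⟨_, Or.inr rfl, Or.inr rfl, hw⟩
    | pendant i' a' =>
      obtain ⟨hi, hw⟩ := pendant_meets_step h hp' hp
      exact ⟨_, hi.imp (congrArg _) (congrArg _), Or.inl rfl, hw⟩
  | close i j hi hj =>
    cases h' with
    | step i' j' h' =>
      rcases step_meets_close hn h' hi hj hp' hp with ⟨rfl, hw⟩ | ⟨rfl, hw⟩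
      · exact ⟨_, Or.inl rfl, Or.inl rfl, hw⟩
      · exact ⟨_, Or.inr rfl, Or.inr rfl, hw⟩
    | close i' j' hi' hj' =>
      obtain rfl : i = i' := Fin.ext (by omega)
      obtain rfl : j = j' := Fin.ext (by omega)
      exact absurd rfl hne
    | pendant i' a' =>
      obtain ⟨hi, hw⟩ := pendant_meets_close hi hj hp' hp
      exact ⟨_, hi.imp (congrArg _) (congrArg _), Or.inl rfl, hw⟩
  | pendant i a =>
    cases h' with
    | step i' j' h' =>
      obtain ⟨hi, hw⟩ := pendant_meets_step h' hp hp'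
      exact ⟨_, Or.inl rfl, hi.imp (congrArg _) (congrArg _), hw⟩
    | close i' j' hi' hj' =>
      obtain ⟨hi, hw⟩ := pendant_meets_close hi' hj' hp hp'
      exact ⟨_, Or.inl rfl, hi.imp (congrArg _) (congrArg _), hw⟩
    | pendant i' a' =>
      obtain ⟨rfl, hw⟩ := pendant_meets_pendant (by rintro ⟨⟩; exact hne rfl) hp hp'
      exact ⟨_, Or.inl rfl, Or.inl rfl, hw⟩

theorem isArc_or_isArc_of_adj (hn : 3 ≤ n) {u v : Fin n ⊕ Fin n × Fin k}
    (h : (cycleWithPendants n k).Adj u v) : IsArc u v ∨ IsArc v u := by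
  have key : ∀ i j : Fin n, j.val = (i.val + 1) % n →
      IsArc (k := k) (Sum.inl i) (Sum.inl j) ∨ IsArc (k := k) (Sum.inl j) (Sum.inl i) := by
    intro i j h
    rcases Nat.lt_or_ge (i.val + 1) n with hi | hi
    · rw [Nat.mod_eq_of_lt hi] at h
      exact Or.inl (.step i j h.symm)
    · have hi' : i.val + 1 = n := by omega
      rw [hi', Nat.mod_self] at h
      exact Or.inr (.close j i h hi')
  rcases u with i | ⟨i, a⟩ <;> rcases v with j | ⟨j, b⟩
  · rcases (cycleGraph_adj_iff hn i j).mp h with h | h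
    · exact key i j h
    · exact (key j i h).symm
  · obtain rfl : i = j := h
    exact Or.inl (.pendant i b)
  · obtain rfl : j = i := h
    exact Or.inr (.pendant j a)
  · exact h.elim

theorem parabolaPos_meets (hn : 3 ≤ n) {u v x y : Fin n ⊕ Fin n × Fin k}
    (h : (cycleWithPendants n k).Adj u v) (h' : (cycleWithPendants n k).Adj x y)
    (hne : s(u, v) ≠ s(x, y)) {p : Plane}
    (hp : p ∈ segment ℝ (parabolaPos u) (parabolaPos v))
    (hp' : p ∈ segment ℝ (parabolaPos x) (parabolaPos y)) :
    ∃ w, (w = u ∨ w = v) ∧ (w = x ∨ w = y) ∧ p = parabolaPos w := by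
  wlog huv : IsArc u v generalizing u v
  · rw [segment_symm] at hp
    rw [Sym2.eq_swap] at hne
    obtain ⟨w, hw, hw'⟩ := this h.symm hne hp ((isArc_or_isArc_of_adj hn h).resolve_left huv)
    exact ⟨w, hw.symm, hw'⟩
  wlog hxy : IsArc x y generalizing x y
  · rw [segment_symm] at hp'
    rw [Sym2.eq_swap (a := x)] at hne
    obtain ⟨w, hw, hw', hw''⟩ :=
      this h'.symm hp' hne ((isArc_or_isArc_of_adj hn h').resolve_left hxy)
    exact ⟨w, hw, hw'.symm, hw''⟩
  exact huv.meets hn hxy hne hp hp'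

theorem exists_adj_cycleWithPendants (hn : 3 ≤ n) (w : Fin n ⊕ Fin n × Fin k) :
    ∃ z, (cycleWithPendants n k).Adj w z := by
  rcases w with i | ⟨i, a⟩
  · exact ⟨Sum.inl ⟨(i.val + 1) % n, Nat.mod_lt _ (by omega)⟩,
      (cycleGraph_adj_iff hn _ _).mpr (Or.inl rfl)⟩
  · exact ⟨Sum.inl i, rfl⟩

/-- The straight-line drawing of the cycle with pendants on the parabola. -/
noncomputable def parabolaDrawing (k : ℕ) (hn : 3 ≤ n) :
    StraightLineDrawing (cycleWithPendants n k) where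
  pos := parabolaPos
  pos_injective := parabolaPos_injective
  eq_or_eq_of_mem_segment u v w huv hw := by
    by_contra hne
    -- an edge at `w` meets `uv` in the point of `w`
    obtain ⟨z, hz⟩ := exists_adj_cycleWithPendants hn w
    have hne' : s(u, v) ≠ s(w, z) := by
      rw [Ne, Sym2.eq_iff]
      rintro (⟨h, -⟩ | ⟨-, h⟩)
      · exact hne (Or.inl h.symm)
      · exact hne (Or.inr h.symm)
    obtain ⟨x, hx, -, hx'⟩ := parabolaPos_meets hn huv hz hne' hw (left_mem_segment ℝ _ _)
    rw [parabolaPos_injective hx'] at hne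
    exact hne hx

end

theorem StraightLineDrawing.mem_outerFace_of_below {V : Type*} {G : SimpleGraph V}
    (D : StraightLineDrawing G) {x y : ℝ} (h : ∀ q ∈ D.support, q 0 = x → y < q 1) :
    !₂[x, y] ∈ D.outerFace := by
  -- the vertical ray downwards from the point avoids the drawing
  have hsub : (fun t : ℝ => (!₂[x, t] : Plane)) '' Set.Iic y ⊆ D.supportᶜ := by
    rintro _ ⟨t, ht, rfl⟩ hmem
    exact not_lt_of_ge ht (by simpa using h _ hmem (by simp))
  have hcont : Continuous fun t : ℝ => (!₂[x, t] : Plane) := by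
    refine (PiLp.continuous_toLp 2 _).comp (continuous_pi fun i => ?_)
    fin_cases i
    · exact continuous_const
    · exact continuous_id
  have hmem : !₂[x, y] ∈ (fun t : ℝ => (!₂[x, t] : Plane)) '' Set.Iic y :=
    Set.mem_image_of_mem _ (Set.mem_Iic.mpr le_rfl)
  refine ⟨hsub hmem, fun hb => ?_⟩
  have hb' := hb.subset ((isPreconnected_Iic.image _ hcont.continuousOn).subset_connectedComponentIn
    hmem hsub)
  obtain ⟨R, hR⟩ := hb'.exists_norm_le
  have h1 := hR _ (Set.mem_image_of_mem _ (Set.mem_Iic.mpr (min_le_left y (-|R| - 1))))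
  have h2 := (PiLp.norm_apply_le (!₂[x, min y (-|R| - 1)] : Plane) 1).trans h1
  simp only [Matrix.cons_val_one, Matrix.cons_val_zero, Real.norm_eq_abs] at h2
  linarith [neg_abs_le (min y (-|R| - 1)), min_le_right y (-|R| - 1), le_abs_self R]

theorem mem_closure_of_forall_Ioo {S : Set Plane} {x y a b : ℝ}
    (h : ∀ ε : ℝ, 0 < ε → ε < 1 / 2 → !₂[x - a * ε, y - b * ε] ∈ S) : !₂[x, y] ∈ closure S := by
  have hcont : Continuous fun ε : ℝ => (!₂[x - a * ε, y - b * ε] : Plane) := by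
    refine (PiLp.continuous_toLp 2 _).comp (continuous_pi fun i => ?_)
    fin_cases i
    · exact continuous_const.sub (continuous_const.mul continuous_id)
    · exact continuous_const.sub (continuous_const.mul continuous_id)
  have ht := (hcont.tendsto 0).mono_left (nhdsWithin_le_nhds (s := Set.Ioi 0))
  simp only [mul_zero, sub_zero] at ht
  refine mem_closure_of_tendsto ht ?_
  filter_upwards [Ioo_mem_nhdsGT (by norm_num : (0 : ℝ) < 1 / 2)] with ε hε
  exact h ε hε.1 hε.2

section

variable {n k : ℕ}

theorem exists_isArc_of_mem_support (hn : 3 ≤ n) {q : Plane}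
    (hq : q ∈ (parabolaDrawing k hn).support) :
    ∃ u v : Fin n ⊕ Fin n × Fin k, IsArc u v ∧
      q ∈ segment ℝ (parabolaPos u) (parabolaPos v) := by
  have key : ∀ u v, (cycleWithPendants n k).Adj u v →
      q ∈ segment ℝ (parabolaPos u) (parabolaPos v) →
      ∃ u v : Fin n ⊕ Fin n × Fin k, IsArc u v ∧
        q ∈ segment ℝ (parabolaPos u) (parabolaPos v) := by
    intro u v huv hq
    rcases isArc_or_isArc_of_adj hn huv with h | h
    · exact ⟨u, v, h, hq⟩
    · exact ⟨v, u, h, segment_symm ℝ (parabolaPos u) (parabolaPos v) ▸ hq⟩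
  rcases hq with ⟨w, rfl⟩ | ⟨u, v, huv, hq⟩
  · obtain ⟨z, hz⟩ := exists_adj_cycleWithPendants hn w
    exact key w z hz (left_mem_segment ℝ _ _)
  · exact key u v huv hq

theorem neg_one_le_of_mem_support (hn : 3 ≤ n) {q : Plane}
    (hq : q ∈ (parabolaDrawing k hn).support) : -1 ≤ q 1 := by
  obtain ⟨u, v, huv, hq⟩ := exists_isArc_of_mem_support hn hq
  cases huv with
  | step i j h =>
    obtain ⟨t, h0, h1, hx, hy⟩ := coords_of_mem_step h hq
    have : 0 ≤ (i : ℝ) ^ 2 + (2 * i + 1) * t := by positivity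
    linarith
  | close i j hi hj =>
    obtain ⟨h0, h1, hy⟩ := coords_of_mem_close hi hj hq
    have : 0 ≤ ((n : ℝ) - 1) * q 0 := mul_nonneg (h0.trans h1) h0
    linarith
  | pendant i a =>
    obtain ⟨t, h0, h1, hx, hy⟩ := coords_of_mem_pendant hq
    nlinarith [mul_nonneg (sub_nonneg.mpr h1) (sq_nonneg (i : ℝ))]

theorem lt_of_mem_support_left (hn : 3 ≤ n) (i : Fin n) {ε : ℝ} (h0 : 0 < ε) (h1 : ε < 1 / 2)
    {q : Plane} (hq : q ∈ (parabolaDrawing k hn).support) (hx : q 0 = i - ε) :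
    (i : ℝ) ^ 2 - 2 * n * ε < q 1 := by
  obtain ⟨u, v, huv, hq⟩ := exists_isArc_of_mem_support hn hq
  have hin : (i : ℝ) + 1 ≤ n := by exact_mod_cast i.isLt
  have hi0 : (0 : ℝ) ≤ i := by positivity
  cases huv with
  | step j j' h =>
    obtain ⟨t, ht0, ht1, hx', hy⟩ := coords_of_mem_step h hq
    have hji : (j : ℝ) + 1 = i := by
      rcases lt_trichotomy (j.val + 1) i.val with hlt | heq | hgt
      · have : (j : ℝ) + 1 + 1 ≤ i := by exact_mod_cast hlt
        linarith
      · exact_mod_cast heq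
      · have : (i : ℝ) ≤ j := by exact_mod_cast (by omega : i.val ≤ j.val)
        linarith
    have ht : t = 1 - ε := by linarith
    have hj : (j : ℝ) = i - 1 := by linarith
    rw [hy, ht, hj]
    have : 0 < (2 * (n : ℝ) - 2 * i + 1) * ε := mul_pos (by linarith) h0
    linarith
  | close j j' hj hj' =>
    obtain ⟨-, -, hy⟩ := coords_of_mem_close hj hj' hq
    rw [hy, hx]
    have h2 : 0 < ((n : ℝ) + 1) * ε := by positivity
    have h3 : 0 ≤ (i : ℝ) * (n - 1 - i) := mul_nonneg hi0 (by linarith)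
    linarith
  | pendant j a =>
    exfalso
    obtain ⟨t, ht0, ht1, hx', hy⟩ := coords_of_mem_pendant hq
    have ha := offset_nonneg a
    have ha' := offset_le_half a
    have h2 : (i : ℝ) = j + (t * ((a : ℝ) / (2 * (k + 1))) + ε) := by linarith
    have h3 : 0 ≤ t * ((a : ℝ) / (2 * (k + 1))) := mul_nonneg ht0 ha
    have h4 : t * ((a : ℝ) / (2 * (k + 1))) ≤ 1 / 2 := by nlinarith
    have h5 : j.val < i.val := by
      have : (j : ℝ) < i := by linarith
      exact_mod_cast this
    have h6 : (j : ℝ) + 1 ≤ i := by exact_mod_cast h5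
    linarith

theorem isOuterplanar_parabolaDrawing (hn : 3 ≤ n) : (parabolaDrawing k hn).IsOuterplanar := by
  refine ⟨fun u v x y huv hxy hne p hp hp' => parabolaPos_meets hn huv hxy hne hp hp',
    fun w => ⟨?_, fun hint => (interior_subset hint).1 (Or.inl ⟨w, rfl⟩)⟩⟩
  rcases w with i | b
  · refine mem_closure_of_forall_Ioo (a := 1) (b := 2 * n) fun ε h0 h1 => ?_
    refine StraightLineDrawing.mem_outerFace_of_below _ fun q hq hx => ?_
    rw [one_mul] at hx
    exact lt_of_mem_support_left hn i h0 h1 hq hx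
  · refine mem_closure_of_forall_Ioo (a := 0) (b := 1) fun ε h0 h1 => ?_
    refine StraightLineDrawing.mem_outerFace_of_below _ fun q hq _ => ?_
    linarith [neg_one_le_of_mem_support hn hq]

end

/-! ### Subgraphs of outerplanar graphs and the triangle -/

/-- The drawing of a subgraph obtained by restricting a drawing. -/
def StraightLineDrawing.comap {V W : Type*} {G : SimpleGraph V} {H : SimpleGraph W}
    (D : StraightLineDrawing G) (f : H →g G) (hf : Function.Injective f) :
    StraightLineDrawing H where
  pos := D.pos ∘ f
  pos_injective := D.pos_injective.comp hf
  eq_or_eq_of_mem_segment u v w huv hw :=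
    (D.eq_or_eq_of_mem_segment (f u) (f v) (f w) (f.map_adj huv) hw).imp (@hf _ _) (@hf _ _)

theorem StraightLineDrawing.IsOuterplanar.comap {V W : Type*} {G : SimpleGraph V}
    {H : SimpleGraph W} {D : StraightLineDrawing G} (hD : D.IsOuterplanar) (f : H →g G)
    (hf : Function.Injective f) : (D.comap f hf).IsOuterplanar := by
  have hsupp : (D.comap f hf).support ⊆ D.support := by
    rintro p (⟨w, rfl⟩ | ⟨u, v, huv, hp⟩)
    · exact Or.inl ⟨f w, rfl⟩
    · exact Or.inr ⟨f u, f v, f.map_adj huv, hp⟩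
  have hface : D.outerFace ⊆ (D.comap f hf).outerFace := fun p hp =>
    ⟨fun h => hp.1 (hsupp h), fun hb => hp.2 (hb.subset
      (connectedComponentIn_mono p (Set.compl_subset_compl.mpr hsupp)))⟩
  refine ⟨fun u v x y huv hxy hne p hp hp' => ?_, fun w => ⟨?_, fun hint => ?_⟩⟩
  · have hne' : s(f u, f v) ≠ s(f x, f y) := fun h =>
      hne (Sym2.map.injective hf (by simpa using h))
    obtain ⟨w, hw, hw', hpw⟩ :=
      hD.1 _ _ _ _ (f.map_adj huv) (f.map_adj hxy) hne' p hp hp'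
    rcases hw with rfl | rfl
    · exact ⟨u, Or.inl rfl, hw'.imp (@hf _ _) (@hf _ _), hpw⟩
    · exact ⟨v, Or.inr rfl, hw'.imp (@hf _ _) (@hf _ _), hpw⟩
  · exact closure_mono hface (frontier_subset_closure (hD.2 (f w)))
  · exact (interior_subset hint).1 (Or.inl ⟨w, rfl⟩)

theorem isOuterplanarGraph_completeGraph_three :
    IsOuterplanarGraph (SimpleGraph.completeGraph (Fin 3)) := by
  let f : SimpleGraph.completeGraph (Fin 3) →g cycleWithPendants 3 0 :=
    { toFun := Sum.inl
      map_rel' := fun {a b} h => by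
        change (SimpleGraph.cycleGraph 3).Adj a b
        rw [SimpleGraph.cycleGraph_three_eq_top]
        exact h }
  exact ⟨_, (isOuterplanar_parabolaDrawing (k := 0) le_rfl).comap f Sum.inl_injective⟩

namespace StraightLineDrawing

variable {V : Type*} {G : SimpleGraph V}

theorem slope_comm (D : StraightLineDrawing G) (u v : V) : D.slope u v = D.slope v u := by
  unfold slope
  rw [Set.pair_comm]

/-- Two sides of a drawn triangle are not parallel. -/
theorem slope_ne_slope (D : StraightLineDrawing G) {u v w : V} (huv : G.Adj u v)
    (huw : G.Adj u w) (hvw : G.Adj v w) : D.slope u v ≠ D.slope u w := by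
  intro h
  obtain ⟨r, hr⟩ := D.exists_smul_eq_of_slope_eq h
  rcases le_or_gt 0 r with h0 | h0
  · exact D.not_sameRay huv huw hvw.ne (hr ▸ SameRay.sameRay_nonneg_smul_left _ h0)
  · have hv : D.pos v = r • (D.pos w - D.pos u) + D.pos u := by rw [hr, sub_add_cancel]
    have hpos : 0 < 1 - r := by linarith
    have hmem : D.pos u ∈ segment ℝ (D.pos v) (D.pos w) := by
      refine ⟨1 / (1 - r), -r / (1 - r), by positivity,
        div_nonneg (by linarith) hpos.le, by field_simp; ring, ?_⟩
      rw [hv]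
      ext i
      simp only [PiLp.add_apply, PiLp.smul_apply, PiLp.sub_apply, smul_eq_mul]
      field_simp
      ring
    rcases D.eq_or_eq_of_mem_segment v w u hvw hmem with h | h
    · exact huv.ne h
    · exact huw.ne h

end StraightLineDrawing

theorem three_le_of_encard_slopes {D : StraightLineDrawing (SimpleGraph.completeGraph (Fin 3))}
    {s : ℕ} (hs : D.slopes.encard = s) : 3 ≤ s := by
  have hadj : ∀ u v : Fin 3, u ≠ v → (SimpleGraph.completeGraph (Fin 3)).Adj u v :=
    fun _ _ h => h
  have h01 := hadj 0 1 (by decide)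
  have h02 := hadj 0 2 (by decide)
  have h12 := hadj 1 2 (by decide)
  have h1 := D.slope_ne_slope h01 h02 h12
  have h2 := D.slope_ne_slope h01.symm h12 h02
  have h3 := D.slope_ne_slope h02.symm h12.symm h01
  rw [D.slope_comm 1 0] at h2
  rw [D.slope_comm 2 0, D.slope_comm 2 1] at h3
  have hsub : {D.slope 0 1, D.slope 0 2, D.slope 1 2} ⊆ D.slopes := by
    rintro σ (rfl | rfl | rfl)
    · exact ⟨_, _, h01, rfl⟩
    · exact ⟨_, _, h02, rfl⟩
    · exact ⟨_, _, h12, rfl⟩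
  have hcard : Set.encard {D.slope 0 1, D.slope 0 2, D.slope 1 2} = 3 :=
    Set.encard_eq_three.mpr ⟨_, _, _, h1, h2, h3, rfl⟩
  have := Set.encard_le_encard hsub
  rw [hcard, hs] at this
  exact_mod_cast this

/-- The infimum defining the slope number is attained for finite outerplanar graphs, so a bound for
all outerplanar drawings is a bound for it. -/
theorem le_outerplanarSlopeNumber {V : Type*} [Finite V] {G : SimpleGraph V}
    (hG : IsOuterplanarGraph G) {m : ℕ}
    (h : ∀ (D : StraightLineDrawing G) (s : ℕ), D.IsOuterplanar → D.slopes.encard = s → m ≤ s) :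
    m ≤ outerplanarSlopeNumber G := by
  obtain ⟨D, hD⟩ := hG
  have hne : {s : ℕ | ∃ D : StraightLineDrawing G,
      D.IsOuterplanar ∧ D.slopes.encard = (s : ℕ∞)}.Nonempty :=
    ⟨D.slopes.ncard, D, hD, (D.slopes_finite.cast_ncard_eq).symm⟩
  obtain ⟨D', hD', hs⟩ := Nat.sInf_mem hne
  exact h D' _ hD' hs

/-! ### Degrees -/

theorem degree_cycleWithPendants_inl {n k : ℕ} (hn : 3 ≤ n) (i : Fin n) :
    (cycleWithPendants n k).degree (Sum.inl i) = 2 + k := by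
  obtain ⟨m, rfl⟩ := Nat.exists_eq_add_of_le' hn
  have h : (cycleWithPendants (m + 3) k).neighborFinset (Sum.inl i) =
      ((SimpleGraph.cycleGraph (m + 3)).neighborFinset i).disjSum
        (Finset.univ.image fun a => (i, a)) := by
    ext (j | ⟨j, a⟩)
    · rw [SimpleGraph.mem_neighborFinset, Finset.inl_mem_disjSum, SimpleGraph.mem_neighborFinset]
      exact Iff.rfl
    · rw [SimpleGraph.mem_neighborFinset, Finset.inr_mem_disjSum]
      change i = j ↔ _
      simp
  rw [← SimpleGraph.card_neighborFinset_eq_degree, h, Finset.card_disjSum,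
    SimpleGraph.card_neighborFinset_eq_degree, SimpleGraph.cycleGraph_degree_three_le,
    Finset.card_image_of_injective _ (Prod.mk_right_injective i), Finset.card_univ,
    Fintype.card_fin]

theorem degree_cycleWithPendants_inr {n k : ℕ} (b : Fin n × Fin k) :
    (cycleWithPendants n k).degree (Sum.inr b) = 1 := by
  have h : (cycleWithPendants n k).neighborFinset (Sum.inr b) = {Sum.inl b.1} := by
    ext (j | c)
    · rw [SimpleGraph.mem_neighborFinset]
      change j = b.1 ↔ _
      simp
    · rw [SimpleGraph.mem_neighborFinset]
      change False ↔ _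
      simp
  rw [← SimpleGraph.card_neighborFinset_eq_degree, h, Finset.card_singleton]

theorem maxDegree_cycleWithPendants {n k : ℕ} (hn : 3 ≤ n) :
    (cycleWithPendants n k).maxDegree = 2 + k := by
  apply le_antisymm
  · refine SimpleGraph.maxDegree_le_of_forall_degree_le _ _ ?_
    rintro (i | b)
    · rw [degree_cycleWithPendants_inl hn]
    · rw [degree_cycleWithPendants_inr]; omega
  · rw [← degree_cycleWithPendants_inl hn ⟨0, by omega⟩]
    exact SimpleGraph.degree_le_maxDegree _ _

/-! ### The slope numbers -/

theorem mainTheorem2 :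
    (∀ Δ : ℕ, 4 ≤ Δ →
      IsOuterplanarGraph (cycleWithPendants (2 * Δ - 3) (Δ - 2)) ∧
      (cycleWithPendants (2 * Δ - 3) (Δ - 2)).maxDegree = Δ ∧
      Δ - 1 ≤ outerplanarSlopeNumber (cycleWithPendants (2 * Δ - 3) (Δ - 2))) ∧
    (IsOuterplanarGraph (SimpleGraph.completeGraph (Fin 3)) ∧
      (SimpleGraph.completeGraph (Fin 3)).maxDegree = 2 ∧
      3 ≤ outerplanarSlopeNumber (SimpleGraph.completeGraph (Fin 3))) := by
  refine ⟨fun Δ hΔ => ?_, isOuterplanarGraph_completeGraph_three, by decide,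
    le_outerplanarSlopeNumber isOuterplanarGraph_completeGraph_three
      fun D s _ hs => three_le_of_encard_slopes hs⟩
  have hn : 3 ≤ 2 * Δ - 3 := by omega
  have hG : IsOuterplanarGraph (cycleWithPendants (2 * Δ - 3) (Δ - 2)) :=
    ⟨_, isOuterplanar_parabolaDrawing hn⟩
  refine ⟨hG, ?_, le_outerplanarSlopeNumber hG fun D s hD hs => ?_⟩
  · rw [maxDegree_cycleWithPendants hn]; omega
  · have h := mul_le_mul_of_encard_slopes hn (by omega) hD hs
    by_contra! hlt
    obtain ⟨d, rfl⟩ := Nat.exists_eq_add_of_le' (by omega : 2 ≤ Δ)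
    -- with `Δ - 2` slopes the angle count of the cycle fails by exactly one
    have h1 : (2 * (d + 2) - 3 + 2) * s ≤ (2 * (d + 2) - 3 + 2) * d :=
      Nat.mul_le_mul_left _ (by omega)
    rw [show 2 * (d + 2) - 3 = 2 * d + 1 by omega, show d + 2 - 2 = d by omega] at h
    rw [show 2 * (d + 2) - 3 = 2 * d + 1 by omega] at h1
    nlinarith
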